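/- Let $L,H,d,p\ge 1$ be integers and put $B=Hdp$, $$K=(HdpL)^8\cdot 8^{2L^2},\qquad m=K^{\left(\sum_{\ell=0}^{L-1}8^{\ell}\right)+1},\qquad n_\ell=K^{4\cdot 8^{L-\ell-1}}\ (1\le \ell\le L-1),\qquad N_\ell=m\prod_{\ell'=1}^{\ell}n_{\ell'}\ (0\le\ell\le L-1).$$ **Task.** An instance of $L\text{-}\mathsf{FuncComp}$ consists of a query $w=(w_1,\dots,w_{L-1})\in[n_1]\times\cdots\times[n_{L-1}]$, an element $z_0\in[m]=[N_0]$, and functions $z_\ell:[N_{\ell-1}]\to[N_{\ell-1}]$ for $1\le\ell\le L$. Identify $[n_\ell]\times[N_{\ell-1}]$ with $[N_\ell]$ by a fixed bijection. Put $i_1=z_1(z_0)\in[N_0]$ and $i_{\ell+1}=z_{\ell+1}(w_\ell,i_\ell)\in[N_\ell]$ for $1\le\ell\le L-1$. The required answer is $L\text{-}\mathsf{FuncComp}(w,z_0,\dots,z_L)=i_L\in[N_{L-1}]$. **Model.** There are $L+2$ players, named $-1,0,1,\dots,L$. Player $-1$ receives $w$ and player $0$ receives $z_0$, each described by one token ($m_{(-1)}=m_{(0)}=1$);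 player $\ell\in\{1,\dots,L\}$ receives $z_\ell$, described by $m_{(\ell)}=N_{\ell-1}$ tokens. In a deterministic autoregressive communication protocol with $L$ epochs and $B$ message bits per token, let $X_i^{(\ell)}$ be the information held by player $i$ after $\ell$ epochs; $X_i^{(0)}$ is the input of player $i$. In epoch $\ell=1,\dots,L$, for all players $i<j$, player $j$ sends to player $i$ a message $\Pi^{(\ell)}_{j,i}\in\{0,1\}^{2B\,m_{(i)}}$ that is a function (fixed by the protocol) of $X_j^{(\ell-1)}$ and $X_i^{(\ell-1)}$; then $X_i^{(\ell)}$ consists of $X_i^{(\ell-1)}$ together with the messages $\Pi^{(\ell)}_{j,i}$ for all $j>i$. Nothing else is remembered. After epoch $L$, player $-1$ outputs a function of $X_{-1}^{(L)}$. The protocol solves $L\text{-}\mathsf{FuncComp}$ if for every instance this output equals $L\text{-}\mathsf{FuncComp}(w,z_0,\dots,z_L)$. **Theorem.** No deterministic autoregressive communication protocol with $L$ epochs and $B=Hdp$ message bits per token solves $L\text{-}\mathsf{FuncComp}$ with these parameters. -/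

import Mathlib

namespace ARComm

/-! ## The autoregressive communication model

There are `L + 2` players `-1, 0, …, L`; player `i` is represented by the index
`i + 1 : Fin (L + 2)`.  So index `0` is player `-1` and index `1` is player `0`. -/

/-- A message sent to a player whose input has `t` tokens: a string of exactly `2 * B * t` bits. -/
abbrev Msg (B t : ℕ) : Type := Fin (2 * B * t) → Bool

/-- The set of possible values of the information `X_i^{(ℓ)}` collected by player `i` after `ℓ`
epochs: initially the input of `i`; each epoch adds one message from every player `j > i`. -/
def Info {L : ℕ} (Input : Fin (L + 2) → Type) (tok : Fin (L + 2) → ℕ) (B : ℕ) :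
    ℕ → Fin (L + 2) → Type
  | 0, i => Input i
  | ℓ + 1, i => Info Input tok B ℓ i × ({j : Fin (L + 2) // i < j} → Msg B (tok i))

/-- A deterministic autoregressive communication protocol with `L` epochs and `B` message bits,
where player `i` has an input in `Input i` consisting of `tok i` tokens. -/
structure Protocol (L : ℕ) (Input : Fin (L + 2) → Type) (tok : Fin (L + 2) → ℕ) (B : ℕ)
    (Out : Type) where
  /-- In epoch `ℓ + 1`, player `j > i` sends to player `i` a message that depends on the
  information that `j` and `i` have collected in the first `ℓ` epochs. -/
  message : ∀ ℓ : ℕ, ℓ < L → ∀ j i : Fin (L + 2), i < j →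
    Info Input tok B ℓ j → Info Input tok B ℓ i → Msg B (tok i)
  /-- After `L` epochs, player `-1` answers from its own information. -/
  output : Info Input tok B L 0 → Out

namespace Protocol

variable {L : ℕ} {Input : Fin (L + 2) → Type} {tok : Fin (L + 2) → ℕ} {B : ℕ} {Out : Type}

/-- The information collected by player `i` after `ℓ ≤ L` epochs, when the input is `z`. -/
def info (P : Protocol L Input tok B Out) (z : ∀ i, Input i) :
    ∀ ℓ : ℕ, ℓ ≤ L → ∀ i : Fin (L + 2), Info Input tok B ℓ i
  | 0, _, i => z i
  | ℓ + 1, h, i =>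
    (P.info z ℓ (Nat.le_of_succ_le h) i,
      fun j => P.message ℓ h j.1 i j.2
        (P.info z ℓ (Nat.le_of_succ_le h) j.1) (P.info z ℓ (Nat.le_of_succ_le h) i))

/-- The answer of player `-1` at the end of the protocol, when the input is `z`. -/
def run (P : Protocol L Input tok B Out) (z : ∀ i, Input i) : Out :=
  P.output (P.info z L le_rfl 0)

end Protocol

/-! ## Sequential function composition

Finite sets `[k]` are represented by `Fin k`. -/

/-- `N_ℓ = m * n_1 * ⋯ * n_ℓ`. -/
def bigN (m : ℕ) (n : ℕ → ℕ) (ℓ : ℕ) : ℕ := m * ∏ k ∈ Finset.Icc 1 ℓ, n k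

theorem bigN_zero (m : ℕ) (n : ℕ → ℕ) : m = bigN m n 0 := by
  simp [bigN]

theorem bigN_succ (m : ℕ) (n : ℕ → ℕ) (ℓ : ℕ) :
    n (ℓ + 1) * bigN m n ℓ = bigN m n (ℓ + 1) := by
  unfold bigN
  rw [Finset.prod_Icc_succ_top (by omega)]
  ring

/-- The identification of `[n_{ℓ+1}] × [N_ℓ]` with `[N_{ℓ+1}]`. -/
def pair (m : ℕ) (n : ℕ → ℕ) (ℓ : ℕ) (w : Fin (n (ℓ + 1))) (i : Fin (bigN m n ℓ)) :
    Fin (bigN m n (ℓ + 1)) :=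
  Fin.cast (bigN_succ m n ℓ) (finProdFinEquiv (w, i))

/-- Queries `w = (w_1, …, w_{L-1})` in `[n_1] × ⋯ × [n_{L-1}]`; `w_{k+1}` is `w k`. -/
abbrev Query (L : ℕ) (n : ℕ → ℕ) : Type := ∀ k : Fin (L - 1), Fin (n (k.1 + 1))

/-- Sequences `z_1, …, z_L` of functions `z_ℓ : [N_{ℓ-1}] → [N_{ℓ-1}]`; `z_{k+1}` is `f k`. -/
abbrev Funs (L m : ℕ) (n : ℕ → ℕ) : Type :=
  ∀ k : Fin L, Fin (bigN m n k.1) → Fin (bigN m n k.1)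

/-- The partial composition value `i_{ℓ+1}` in `[N_ℓ]`, for `ℓ < L`: `i_1 = z_1(z_0)` and
`i_{ℓ+2} = z_{ℓ+2}(w_{ℓ+1}, i_{ℓ+1})`. -/
def partialComp {L m : ℕ} {n : ℕ → ℕ} (w : Query L n) (z₀ : Fin m) (f : Funs L m n) :
    ∀ ℓ : ℕ, ℓ < L → Fin (bigN m n ℓ)
  | 0, h => f ⟨0, h⟩ (Fin.cast (bigN_zero m n) z₀)
  | ℓ + 1, h => f ⟨ℓ + 1, h⟩
      (pair m n ℓ (w ⟨ℓ, by omega⟩) (partialComp w z₀ f ℓ (Nat.lt_of_succ_lt h)))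

/-- `L-FuncComp(w, z_0, …, z_L) = i_L` in `[N_{L-1}]`. -/
def funcComp {L m : ℕ} {n : ℕ → ℕ} (hL : 1 ≤ L) (w : Query L n) (z₀ : Fin m)
    (f : Funs L m n) : Fin (bigN m n (L - 1)) :=
  partialComp w z₀ f (L - 1) (by omega)

/-- The inputs of the players: player `-1` has the query `w`, player `0` has `z_0` in `[m]`, and
player `ℓ` in `[L]` has `z_ℓ`. -/
def FCInput (L m : ℕ) (n : ℕ → ℕ) : Fin (L + 2) → Type
  | ⟨0, _⟩ => Query L n
  | ⟨1, _⟩ => Fin m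
  | ⟨k + 2, _⟩ => Fin (bigN m n k) → Fin (bigN m n k)

/-- The number of tokens of each input: `1` for players `-1` and `0`, and `N_{ℓ-1}` for player
`ℓ` in `[L]`. -/
def fcTokens (L m : ℕ) (n : ℕ → ℕ) : Fin (L + 2) → ℕ
  | ⟨0, _⟩ => 1
  | ⟨1, _⟩ => 1
  | ⟨k + 2, _⟩ => bigN m n k

/-- Distribution of `(w, z_0, z_1, …, z_L)` to the players. -/
def fcInput {L m : ℕ} {n : ℕ → ℕ} (w : Query L n) (z₀ : Fin m) (f : Funs L m n) :
    ∀ i : Fin (L + 2), FCInput L m n i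
  | ⟨0, _⟩ => w
  | ⟨1, _⟩ => z₀
  | ⟨k + 2, h⟩ => f ⟨k, by omega⟩

/-- Autoregressive protocols for `L-FuncComp`, with `L` epochs and `B` message bits. -/
abbrev FCProtocol (L m : ℕ) (n : ℕ → ℕ) (B : ℕ) : Type :=
  Protocol L (FCInput L m n) (fcTokens L m n) B (Fin (bigN m n (L - 1)))

/-- The protocol answers `L-FuncComp(w, z_0, …, z_L)` on every input. -/
def SolvesFuncComp {L m : ℕ} {n : ℕ → ℕ} {B : ℕ} (hL : 1 ≤ L) (P : FCProtocol L m n B) : Prop :=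
  ∀ (w : Query L n) (z₀ : Fin m) (f : Funs L m n), P.run (fcInput w z₀ f) = funcComp hL w z₀ f

/-! ## The parameters -/

/-- `K = (H d p L)^8 * 8^(2 L^2)`. -/
def paramK (L H d p : ℕ) : ℕ := (H * d * p * L) ^ 8 * 8 ^ (2 * L ^ 2)

/-- `m = K^((8^0 + 8^1 + ⋯ + 8^(L-1)) + 1)`. -/
def paramM (L H d p : ℕ) : ℕ := paramK L H d p ^ ((∑ ℓ ∈ Finset.range L, 8 ^ ℓ) + 1)

/-- `n_ℓ = K^(4 * 8^(L-ℓ-1))`, used for `1 ≤ ℓ ≤ L - 1` only. -/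
def paramN (L H d p : ℕ) (ℓ : ℕ) : ℕ := paramK L H d p ^ (4 * 8 ^ (L - ℓ - 1))

end ARComm

/-!
The proof follows a protocol epoch by epoch and keeps alive many inputs that the early players
cannot tell apart.  For `k = 0, …, L - 1` it maintains a set `Z₀` of values of `z_0`, small sets
`Z_j` of values of `z_{j+1}` for `j < k`, and a set `R` of continuations (values of the functions
from position `k` on) whose density among all continuations is at least `2 ^ (-Δ)`, such that for
every fixed query and prefix

* after `k` epochs the information of each of the players `0, …, k` does not depend on the
  continuation in `R` (`PrefixBlind`),
* after `k + 1` epochs the same is true of player `-1` (`QueryBlind`),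
* at least `4 * Δ` arguments of `z_{k+1}`, and at least four, occur for some query and prefix
  (`reached`).

At `k = L - 1` the answer of player `-1` does not depend on the continuation `z_L` in `R`.  But
functions from a set of density `2 ^ (-Δ)` cannot all agree on more than `Δ` points, so two of them
differ at a reached point, and for one of the two the answer is wrong (`not_solves_of_queryBlind`).

To go from `k` to `k + 1`, a few values of `z_{k+1}` are chosen that have a dense common set of
continuations inside `R` and that map the reached points to almost as many different values as is
conceivable (`exists_spread_slices`); these values, paired with all `w_{k+1}`, are the new reached
points.  Then the messages are fixed by the pigeonhole principle.  A message to player `i` depends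
only on the inputs of the players from `i` on, so for the players `0, …, k + 1` there are few
prefixes to be treated (`exists_prefixBlind`).  For player `-1` there is one prefix for every
query, which would be too many, were it not for the order of the epochs: the message it receives
from a later player in epoch `k + 2` depends on its information after epoch `k + 1`, in which
`z_{k+1}` plays no role yet.  Hence the number of values of `z_{k+1}` does not enter the cost
(`exists_queryBlind_succ`), and as that number is a factor in the number of reached points, the cost
is small in comparison.  `Regime` collects the inequalities between the parameters that make all
this work, `exists_blind` is the induction, and `regime_param` checks the inequalities.
-/

namespace ARComm

/-! ### Counting dense families of functions -/

open Classical in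
/-- Pigeonhole: some fibre of `g` on `R` has at least the average size. -/
theorem exists_large_fiber {α β : Type*} [Fintype β] (R : Finset α) (g : α → β) :
    ∃ R' ⊆ R, (∀ a ∈ R', ∀ b ∈ R', g a = g b) ∧ R.card ≤ R'.card * Fintype.card β := by
  rcases R.eq_empty_or_nonempty with rfl | ⟨a, ha⟩
  · exact ⟨∅, by simp⟩
  obtain ⟨b, -, hb⟩ := Finset.exists_max_image (Finset.univ : Finset β)
    (fun b => (R.filter fun a => g a = b).card) ⟨g a, Finset.mem_univ _⟩
  refine ⟨R.filter fun a => g a = b, Finset.filter_subset _ _, ?_, ?_⟩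
  · intro a ha c hc
    rw [(Finset.mem_filter.1 ha).2, (Finset.mem_filter.1 hc).2]
  · rw [Finset.card_eq_sum_card_fiberwise (f := g) (t := Finset.univ) (fun _ _ => by simp)]
    refine (Finset.sum_le_card_nsmul _ _ _ hb).trans ?_
    rw [smul_eq_mul, mul_comm, Finset.card_univ]

open Classical in
/-- A family of functions whose values at each point of `A` are confined to at most `v`
possibilities has density at most `(v / |β|) ^ |A|`. -/
theorem card_mul_pow_le_of_confined {α β : Type*} [Fintype α] [DecidableEq α] [Fintype β]
    (C : Finset (α → β)) (A : Finset α) (V : α → Finset β) (v : ℕ)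
    (hV : ∀ a ∈ A, (V a).card ≤ v) (hC : ∀ z ∈ C, ∀ a ∈ A, z a ∈ V a) :
    C.card * Fintype.card β ^ A.card ≤ v ^ A.card * Fintype.card (α → β) := by
  have h1 : C ⊆ Fintype.piFinset fun a => if a ∈ A then V a else Finset.univ := by
    intro z hz
    rw [Fintype.mem_piFinset]
    intro a
    split_ifs with h
    · exact hC z hz a h
    · exact Finset.mem_univ _
  have h2 : (Fintype.piFinset fun a => if a ∈ A then V a else Finset.univ).card
      ≤ v ^ A.card * Fintype.card β ^ (Aᶜ).card := by
    rw [Fintype.card_piFinset, ← Finset.prod_mul_prod_compl A]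
    refine Nat.mul_le_mul ?_ ?_
    · refine Finset.prod_le_pow_card _ _ _ fun a ha => ?_
      simpa [ha] using hV a ha
    · refine Finset.prod_le_pow_card _ _ _ fun a ha => ?_
      rw [if_neg (Finset.mem_compl.1 ha), Finset.card_univ]
  calc C.card * Fintype.card β ^ A.card
      ≤ v ^ A.card * Fintype.card β ^ (Aᶜ).card * Fintype.card β ^ A.card :=
        Nat.mul_le_mul_right _ ((Finset.card_le_card h1).trans h2)
    _ = v ^ A.card * Fintype.card (α → β) := by
        rw [mul_assoc, ← pow_add, Finset.card_compl_add_card, Fintype.card_fun]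

/-- If `C` has density at least `1 / D` among all functions and `|β| ^ |A| > D`, then two members
of `C` differ at a point of `A`. -/
theorem exists_ne_of_dense {α β : Type*} [Fintype α] [DecidableEq α] [Fintype β] [Nonempty β]
    (C : Finset (α → β)) (A : Finset α) (D : ℕ)
    (hC : Fintype.card (α → β) ≤ C.card * D) (hD : D < Fintype.card β ^ A.card) :
    ∃ z ∈ C, ∃ z' ∈ C, ∃ a ∈ A, z a ≠ z' a := by
  by_contra! hcon
  have hpos : 0 < Fintype.card (α → β) := Fintype.card_pos
  have hCpos : 0 < C.card := Nat.pos_of_mul_pos_right (hpos.trans_le hC)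
  obtain ⟨z, hz⟩ := Finset.card_pos.1 hCpos
  have h := card_mul_pow_le_of_confined C A (fun a => {z a}) 1 (by simp)
    (fun z' hz' a ha => by simpa using hcon z' hz' z hz a ha)
  rw [one_pow, one_mul] at h
  have h2 : C.card * Fintype.card β ^ A.card ≤ C.card * D := h.trans hC
  exact absurd (Nat.le_of_mul_le_mul_left h2 hCpos) (by omega)

open Classical in
/-- A dense family of functions contains a member whose image of `A` has at least `t` points
outside a prescribed small set `U`: otherwise all these images are covered by `U` together with
some set of `t` points, and there are too few functions of that kind. -/
theorem exists_card_image_sdiff_ge {α β : Type*} [Fintype α] [DecidableEq α] [Fintype β]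
    [DecidableEq β] [Nonempty β] (C : Finset (α → β)) (A : Finset α) (U : Finset β) (D t u : ℕ)
    (hC : Fintype.card (α → β) ≤ C.card * D) (ht : t ≤ Fintype.card β) (hU : U.card + t ≤ u)
    (hD : D * Fintype.card β ^ t * u ^ A.card < Fintype.card β ^ A.card) :
    ∃ z ∈ C, t ≤ (A.image z \ U).card := by
  by_contra! hcon
  have hpos : 0 < Fintype.card (α → β) := Fintype.card_pos
  have hCpos : 0 < C.card := Nat.pos_of_mul_pos_right (hpos.trans_le hC)
  have hcov : C ⊆ (Finset.univ.powersetCard t : Finset (Finset β)).biUnion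
      fun T => C.filter fun z => ∀ a ∈ A, z a ∈ U ∪ T := by
    intro z hz
    obtain ⟨T, hT, -, hTc⟩ := Finset.exists_subsuperset_card_eq
      (Finset.subset_univ (A.image z \ U)) (hcon z hz).le (by simpa using ht)
    rw [Finset.mem_biUnion]
    refine ⟨T, by simp [hTc], Finset.mem_filter.2 ⟨hz, fun a ha => ?_⟩⟩
    by_cases h : z a ∈ U
    · exact Finset.mem_union_left _ h
    · exact Finset.mem_union_right _
        (hT (Finset.mem_sdiff.2 ⟨Finset.mem_image_of_mem z ha, h⟩))
  have hbd : ∀ T ∈ (Finset.univ.powersetCard t : Finset (Finset β)),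
      (C.filter fun z => ∀ a ∈ A, z a ∈ U ∪ T).card * Fintype.card β ^ A.card ≤
        u ^ A.card * Fintype.card (α → β) := by
    intro T hT
    refine card_mul_pow_le_of_confined _ A (fun _ => U ∪ T) u (fun a _ => ?_)
      (fun z hz => (Finset.mem_filter.1 hz).2)
    exact (Finset.card_union_le _ _).trans (by rw [(Finset.mem_powersetCard.1 hT).2]; exact hU)
  have h1 : C.card * Fintype.card β ^ A.card ≤
      Fintype.card β ^ t * (u ^ A.card * Fintype.card (α → β)) := by
    calc C.card * Fintype.card β ^ A.card
        ≤ (∑ T ∈ (Finset.univ.powersetCard t : Finset (Finset β)),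
            (C.filter fun z => ∀ a ∈ A, z a ∈ U ∪ T).card) * Fintype.card β ^ A.card :=
          Nat.mul_le_mul_right _ ((Finset.card_le_card hcov).trans Finset.card_biUnion_le)
      _ ≤ (Finset.univ.powersetCard t : Finset (Finset β)).card *
            (u ^ A.card * Fintype.card (α → β)) := by
          rw [Finset.sum_mul]
          exact Finset.sum_le_card_nsmul _ _ _ hbd
      _ ≤ _ := by
          refine Nat.mul_le_mul_right _ ?_
          rw [Finset.card_powersetCard, Finset.card_univ]
          exact Nat.choose_le_pow _ _
  have h2 : C.card * Fintype.card β ^ A.card ≤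
      C.card * (D * Fintype.card β ^ t * u ^ A.card) :=
    h1.trans ((Nat.mul_le_mul_left _ (Nat.mul_le_mul_left _ hC)).trans_eq (by ring))
  exact absurd (Nat.le_of_mul_le_mul_left h2 hCpos) (by omega)

open Classical in
/-- A dense family of functions contains `x` members under which `A` has at least `x * t` images
altogether; they are found greedily. -/
theorem exists_spread {α β : Type*} [Fintype α] [DecidableEq α] [Fintype β]
    [DecidableEq β] [Nonempty β] (C : Finset (α → β)) (A : Finset α) (D t x : ℕ)
    (hC : Fintype.card (α → β) ≤ C.card * D) (ht : t ≤ Fintype.card β)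
    (hD : D * Fintype.card β ^ t * ((x + 1) * t) ^ A.card < Fintype.card β ^ A.card) :
    ∃ g : Fin x → α → β, (∀ i, g i ∈ C) ∧
      x * t ≤ (Finset.univ.biUnion fun i => A.image (g i)).card := by
  have key : ∀ s, s ≤ x → ∃ g : Fin s → α → β, (∀ i, g i ∈ C) ∧
      s * t ≤ (Finset.univ.biUnion fun i => A.image (g i)).card := by
    intro s
    induction s with
    | zero => exact fun _ => ⟨Fin.elim0, fun i => i.elim0, by simp⟩
    | succ s ih =>
      intro hs
      obtain ⟨g, hgC, hg⟩ := ih (by omega)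
      set U := Finset.univ.biUnion fun i => A.image (g i) with hUdef
      have hsub : ∀ z, (Finset.univ.biUnion fun i : Fin (s + 1) =>
          A.image ((Fin.snoc g z : Fin (s + 1) → α → β) i)) = U ∪ (A.image z \ U) := by
        intro z
        ext b
        simp only [Finset.union_sdiff_self_eq_union, Finset.mem_union, hUdef, Finset.mem_biUnion,
          Finset.mem_univ, true_and, Fin.exists_fin_succ', Fin.snoc_castSucc, Fin.snoc_last]
      have hmem : ∀ z ∈ C, ∀ i, (Fin.snoc g z : Fin (s + 1) → α → β) i ∈ C := by
        intro z hz i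
        refine Fin.lastCases ?_ (fun j => ?_) i
        · simpa using hz
        · simpa using hgC j
      -- When the images already fill the next quota, any further member will do.
      have hz : ∃ z ∈ C, (s + 1) * t ≤ (U ∪ (A.image z \ U)).card := by
        by_cases hbig : (s + 1) * t ≤ U.card
        · have hpos : 0 < Fintype.card (α → β) := Fintype.card_pos
          obtain ⟨z, hz⟩ := Finset.card_pos.1 (Nat.pos_of_mul_pos_right (hpos.trans_le hC))
          exact ⟨z, hz, hbig.trans (Finset.card_le_card Finset.subset_union_left)⟩
        · obtain ⟨z, hzC, hz⟩ := exists_card_image_sdiff_ge C A U D t ((x + 1) * t) hC ht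
            (by nlinarith) hD
          refine ⟨z, hzC, ?_⟩
          rw [Finset.card_union_of_disjoint Finset.disjoint_sdiff]
          nlinarith
      obtain ⟨z, hzC, hz⟩ := hz
      exact ⟨Fin.snoc g z, hmem z hzC, by rw [hsub]; exact hz⟩
  exact key x le_rfl

open Classical in
/-- If `R` has density `1 / D` in a finite product, then a fraction `1 / (2 * D)` of the points of
the product lie on a line in direction `k` on which `R` has density at least `1 / (2 * D)`. -/
theorem exists_dense_slices {ι : Type*} [Fintype ι] {α : ι → Type*}
    [∀ i, Fintype (α i)] [DecidableEq ι] (k : ι) (R : Finset (∀ i, α i)) (D : ℕ)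
    (hR : Fintype.card (∀ i, α i) ≤ R.card * D) :
    ∃ G : Finset (∀ i, α i), Fintype.card (∀ i, α i) ≤ G.card * (2 * D) ∧
      ∀ f ∈ G, ∃ C : Finset (α k), (∀ z ∈ C, Function.update f k z ∈ R) ∧
        Fintype.card (α k) ≤ C.card * (2 * D) := by
  set s : (∀ i, α i) → ℕ := fun f =>
    (Finset.univ.filter fun z => Function.update f k z ∈ R).card with hs
  -- The involution `(f, z) ↦ (update f k z, f k)` counts the pairs with `update f k z ∈ R`.
  have hsum : ∑ f, s f = R.card * Fintype.card (α k) := by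
    have e1 : ∑ f, s f = (Finset.univ.filter
        fun p : (∀ i, α i) × α k => Function.update p.1 k p.2 ∈ R).card := by
      simp only [hs, Finset.card_filter]
      rw [← Finset.univ_product_univ, Finset.sum_product]
    have e2 : (R ×ˢ (Finset.univ : Finset (α k))).card = R.card * Fintype.card (α k) := by
      rw [Finset.card_product, Finset.card_univ]
    rw [e1, ← e2]
    refine Finset.card_bij' (fun p _ => (Function.update p.1 k p.2, p.1 k))
      (fun p _ => (Function.update p.1 k p.2, p.1 k)) ?_ ?_ ?_ ?_
    · intro p hp; simpa using hp
    · intro p hp; simpa using hp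
    · intro p _; simp
    · intro p _; simp
  refine ⟨Finset.univ.filter fun f => Fintype.card (α k) ≤ s f * (2 * D), ?_,
    fun f hf => ⟨_, fun z hz => (Finset.mem_filter.1 hz).2, (Finset.mem_filter.1 hf).2⟩⟩
  set M := Fintype.card (∀ i, α i) with hM
  set q := Fintype.card (α k) with hq
  set G := Finset.univ.filter fun f => q ≤ s f * (2 * D)
  rcases Nat.eq_zero_or_pos q with h0 | hqpos
  · have : G = Finset.univ := by
      apply Finset.filter_true_of_mem; intro f _; rw [h0]; exact Nat.zero_le _
    rw [this, Finset.card_univ, ← hM]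
    rcases Nat.eq_zero_or_pos D with hD | hD
    · simp [hD] at hR; simp [hR]
    · nlinarith
  · have hle : ∀ f, s f * (2 * D) ≤ (if f ∈ G then q * (2 * D) else 0) + q := by
      intro f
      by_cases hf : f ∈ G
      · rw [if_pos hf]
        have : s f ≤ q := Finset.card_le_univ _
        nlinarith
      · rw [if_neg hf, zero_add]
        by_contra hcon
        exact hf (Finset.mem_filter.2 ⟨Finset.mem_univ f, (not_le.1 hcon).le⟩)
    have htot : R.card * q * (2 * D) ≤ G.card * (q * (2 * D)) + M * q := by
      rw [← hsum, Finset.sum_mul]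
      refine (Finset.sum_le_sum fun f _ => hle f).trans ?_
      rw [Finset.sum_add_distrib, Finset.sum_ite_mem, Finset.univ_inter, Finset.sum_const,
        Finset.sum_const, Finset.card_univ, smul_eq_mul, smul_eq_mul]
    have h3 : M * q ≤ G.card * (2 * D) * q := by nlinarith
    exact Nat.le_of_mul_le_mul_right h3 hqpos

/-! ### Protocols and partial compositions -/

namespace Protocol

variable {L : ℕ} {Input : Fin (L + 2) → Type} {tok : Fin (L + 2) → ℕ} {B : ℕ} {Out : Type}

/-- What a player knows depends only on the inputs of the players from which messages can reach
it. -/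
theorem info_congr (P : Protocol L Input tok B Out) {z z' : ∀ i, Input i} :
    ∀ (ℓ : ℕ) (h : ℓ ≤ L) (i : Fin (L + 2)), (∀ j, i ≤ j → z j = z' j) →
      P.info z ℓ h i = P.info z' ℓ h i
  | 0, _, i, hz => hz i le_rfl
  | ℓ + 1, h, i, hz => by
    have hi := P.info_congr ℓ (Nat.le_of_succ_le h) i hz
    refine Prod.ext hi (funext fun j => ?_)
    have hj := P.info_congr ℓ (Nat.le_of_succ_le h) j.1 fun j' hj' => hz j' (j.2.le.trans hj')
    change P.message ℓ h j.1 i j.2 _ _ = P.message ℓ h j.1 i j.2 _ _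
    rw [hi, hj]

/-- The messages that player `i` receives in the first `ℓ` epochs. -/
def transcript (P : Protocol L Input tok B Out) (z : ∀ i, Input i) (ℓ : ℕ) (h : ℓ ≤ L)
    (i : Fin (L + 2)) : Fin ℓ → {j : Fin (L + 2) // i < j} → Msg B (tok i) :=
  fun t => (P.info z (t + 1) (by omega) i).2

/-- A player's information consists of its input and the messages it has received. -/
theorem info_eq_of_transcript_eq (P : Protocol L Input tok B Out) {z z' : ∀ i, Input i} :
    ∀ (ℓ : ℕ) (h : ℓ ≤ L) (i : Fin (L + 2)), z i = z' i →
      P.transcript z ℓ h i = P.transcript z' ℓ h i → P.info z ℓ h i = P.info z' ℓ h i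
  | 0, _, _, hz, _ => hz
  | ℓ + 1, h, i, hz, ht => by
    refine Prod.ext ?_ (congrFun ht (Fin.last ℓ))
    refine P.info_eq_of_transcript_eq ℓ (Nat.le_of_succ_le h) i hz (funext fun t => ?_)
    exact congrFun ht t.castSucc

end Protocol

theorem card_messages_le (L B t : ℕ) (i : Fin (L + 2)) :
    Fintype.card ({j : Fin (L + 2) // i < j} → Msg B t) ≤ 2 ^ ((L + 2) * (2 * B * t)) := by
  rw [Fintype.card_fun, Fintype.card_fun, Fintype.card_bool, Fintype.card_fin, ← pow_mul, mul_comm]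
  refine Nat.pow_le_pow_right (by norm_num) (Nat.mul_le_mul_right _ ?_)
  simpa using Fintype.card_subtype_le fun j : Fin (L + 2) => i < j

section FuncComp

variable {L m : ℕ} {n : ℕ → ℕ}

/-- The input of `z_{k+1}` in the evaluation of the composition: `z_0` for `k = 0` and
`(w_k, i_k)` for `k > 0`. -/
def compArg (w : Query L n) (z₀ : Fin m) (f : Funs L m n) :
    ∀ k : ℕ, k < L → Fin (bigN m n k)
  | 0, _ => Fin.cast (bigN_zero m n) z₀
  | k + 1, h => pair m n k (w ⟨k, by omega⟩)
      (f ⟨k, Nat.lt_of_succ_lt h⟩ (compArg w z₀ f k (Nat.lt_of_succ_lt h)))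

theorem partialComp_eq (w : Query L n) (z₀ : Fin m) (f : Funs L m n) :
    ∀ (k : ℕ) (h : k < L), partialComp w z₀ f k h = f ⟨k, h⟩ (compArg w z₀ f k h)
  | 0, _ => rfl
  | k + 1, h => by
    rw [partialComp, partialComp_eq w z₀ f k (Nat.lt_of_succ_lt h), compArg]

theorem compArg_congr {w w' : Query L n} {z₀ : Fin m} {f f' : Funs L m n} :
    ∀ (k : ℕ) (h : k < L), (∀ j : Fin (L - 1), j.1 < k → w j = w' j) →
      (∀ j : Fin L, j.1 < k → f j = f' j) → compArg w z₀ f k h = compArg w' z₀ f' k h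
  | 0, _, _, _ => rfl
  | k + 1, h, hw, hf => by
    have ih := compArg_congr (z₀ := z₀) k (Nat.lt_of_succ_lt h)
      (fun j hj => hw j (by omega)) (fun j hj => hf j (by omega))
    rw [compArg, compArg, hw ⟨k, by omega⟩ (Nat.lt_succ_self k),
      hf ⟨k, Nat.lt_of_succ_lt h⟩ (Nat.lt_succ_self k), ih]

theorem pair_injective2 (m : ℕ) (n : ℕ → ℕ) (k : ℕ) :
    Function.Injective fun p : Fin (n (k + 1)) × Fin (bigN m n k) => pair m n k p.1 p.2 := by
  intro p q h
  exact finProdFinEquiv.injective (Fin.cast_injective _ h)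

/-- The sequence of functions that agrees with `ζ` before position `k` and with `f` from there
on. -/
def hybrid (k : ℕ) (ζ f : Funs L m n) : Funs L m n := fun j => if j.1 < k then ζ j else f j

/-- Lengthening the prefix by one position means replacing the continuation at that position. -/
theorem hybrid_succ (k : Fin L) (ζ f : Funs L m n) :
    hybrid (k.1 + 1) ζ f = hybrid k.1 ζ (Function.update f k (ζ k)) := by
  funext j
  unfold hybrid
  rcases lt_trichotomy j.1 k.1 with h | h | h
  · rw [if_pos h, if_pos (by omega)]
  · obtain rfl : j = k := Fin.ext h
    rw [if_pos (by omega), if_neg (by omega), Function.update_self]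
  · rw [if_neg (by omega), if_neg (by omega), Function.update_of_ne (by rintro rfl; omega)]

/-- The input of a player does not depend on `w` except for player `-1`, does not depend on `z_0`
except for player `0`, and depends on at most one of the functions. -/
theorem fcInput_congr {w w' : Query L n} {z₀ z₀' : Fin m} {f f' : Funs L m n} (i : Fin (L + 2))
    (hw : i.1 = 0 → w = w') (hz : i.1 = 1 → z₀ = z₀')
    (hf : ∀ j : Fin L, i.1 = j.1 + 2 → f j = f' j) : fcInput w z₀ f i = fcInput w' z₀' f' i := by
  obtain ⟨i, hi⟩ := i
  match i, hi with
  | 0, _ => exact hw rfl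
  | 1, _ => exact hz rfl
  | k + 2, h => exact hf ⟨k, by omega⟩ rfl

end FuncComp

/-! ### Making the players blind to the continuation -/

section Indistinguishable

variable {L m : ℕ} {n : ℕ → ℕ} {B : ℕ}

/-- A choice, for each position `j`, of a finite set of functions allowed as `z_{j+1}`. -/
abbrev FunSets (L m : ℕ) (n : ℕ → ℕ) : Type :=
  ∀ k : Fin L, Finset (Fin (bigN m n k.1) → Fin (bigN m n k.1))

/-- After `ℓ` epochs the information of each of the players `0, …, k` is the same for all
continuations `f ∈ R` of a prefix `(z_0, ζ)` with `z_0 ∈ Z₀` and `ζ_j ∈ Z_j` for `j < k`.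
A continuation is encoded as a full sequence of functions whose first `k` members are ignored, so
densities can be measured in `Funs L m n` for every `k`. -/
def PrefixBlind (P : FCProtocol L m n B) (k ℓ : ℕ) (hℓ : ℓ ≤ L) (Z₀ : Finset (Fin m))
    (Z : FunSets L m n) (R : Finset (Funs L m n)) : Prop :=
  ∀ w, ∀ z₀ ∈ Z₀, ∀ ζ : Funs L m n, (∀ j : Fin L, j.1 < k → ζ j ∈ Z j) →
    ∀ f ∈ R, ∀ f' ∈ R, ∀ i : Fin (L + 2), 1 ≤ i.1 → i.1 ≤ k + 1 →
      P.info (fcInput w z₀ (hybrid k ζ f)) ℓ hℓ i = P.info (fcInput w z₀ (hybrid k ζ f')) ℓ hℓ i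

/-- After `ℓ` epochs the information of player `-1` is the same for all continuations `f ∈ R` of a
prefix `(w, z_0, ζ)` with `z_0 ∈ Z₀` and `ζ_j ∈ Z_j` for `j < k`. -/
def QueryBlind (P : FCProtocol L m n B) (k ℓ : ℕ) (hℓ : ℓ ≤ L) (Z₀ : Finset (Fin m))
    (Z : FunSets L m n) (R : Finset (Funs L m n)) : Prop :=
  ∀ w, ∀ z₀ ∈ Z₀, ∀ ζ : Funs L m n, (∀ j : Fin L, j.1 < k → ζ j ∈ Z j) →
    ∀ f ∈ R, ∀ f' ∈ R,
      P.info (fcInput w z₀ (hybrid k ζ f)) ℓ hℓ 0 = P.info (fcInput w z₀ (hybrid k ζ f')) ℓ hℓ 0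

/-- The points at which `z_{k+1}` is evaluated for some query and some prefix in `Z₀` and `Z`. -/
def reached (k : ℕ) (hk : k < L) (Z₀ : Finset (Fin m)) (Z : FunSets L m n) :
    Set (Fin (bigN m n k)) :=
  {a | ∃ w, ∃ z₀ ∈ Z₀, ∃ ζ : Funs L m n, (∀ j : Fin L, j.1 < k → ζ j ∈ Z j) ∧
    compArg w z₀ ζ k hk = a}

theorem PrefixBlind.mono {P : FCProtocol L m n B} {k ℓ : ℕ} {hℓ : ℓ ≤ L} {Z₀ : Finset (Fin m)}
    {Z : FunSets L m n} {R R' : Finset (Funs L m n)} (h : PrefixBlind P k ℓ hℓ Z₀ Z R)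
    (hR : R' ⊆ R) : PrefixBlind P k ℓ hℓ Z₀ Z R' :=
  fun w z₀ hz ζ hζ f hf f' hf' => h w z₀ hz ζ hζ f (hR hf) f' (hR hf')

/-- The prefixes on which the messages to player `i` can depend when the functions before position
`k` come from `Z`: the part that player `i` cannot see is replaced by fixed values. -/
def visiblePrefixes (k : ℕ) (Z₀ : Finset (Fin m)) (Z : FunSets L m n) (c : Fin m)
    (i : Fin (L + 2)) : Finset (Fin m × Funs L m n) :=
  (if i.1 = 1 then Z₀ else {c}) ×ˢ
    Fintype.piFinset fun j : Fin L => if i.1 ≤ j.1 + 2 ∧ j.1 < k then Z j else {id}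

set_option synthInstance.maxSize 1000 in
open Classical in
/-- The players `0, …, k` can be made blind at the cost, for each of them, of all messages it
receives on all prefixes visible to it. -/
theorem exists_prefixBlind (P : FCProtocol L m n B) (k ℓ : ℕ) (hℓ : ℓ ≤ L) (Z₀ : Finset (Fin m))
    (Z : FunSets L m n) (R : Finset (Funs L m n)) (w₀ : Query L n) (c : Fin m) (M : ℕ)
    (hM : ∀ i : Fin (L + 2), 1 ≤ i.1 → i.1 ≤ k + 1 →
      (visiblePrefixes k Z₀ Z c i).card * fcTokens L m n i ≤ M) :
    ∃ R' ⊆ R, PrefixBlind P k ℓ hℓ Z₀ Z R' ∧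
      R.card ≤ R'.card * 2 ^ ((L + 2) * (L * ((L + 2) * (2 * B)) * M)) := by
  let S := visiblePrefixes k Z₀ Z c
  obtain ⟨R', hR', hconst, hcard⟩ := exists_large_fiber R
    fun f (i : {i : Fin (L + 2) // 1 ≤ i.1 ∧ i.1 ≤ k + 1}) (s : S i.1) =>
      P.transcript (fcInput w₀ s.1.1 (hybrid k s.1.2 f)) ℓ hℓ i.1
  refine ⟨R', hR', ?_, hcard.trans (Nat.mul_le_mul_left _ ?_)⟩
  · intro w z₀ hz ζ hζ f hf f' hf' i hi1 hik
    let s : Fin m × Funs L m n := (if i.1 = 1 then z₀ else c,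
      fun j => if i.1 ≤ j.1 + 2 ∧ j.1 < k then ζ j else id)
    have hs : s ∈ S i := by
      refine Finset.mem_product.2 ⟨?_, Fintype.mem_piFinset.2 fun j => ?_⟩
      · by_cases h : i.1 = 1
        · simpa [s, h] using hz
        · simp [s, h]
      · by_cases h : i.1 ≤ j.1 + 2 ∧ j.1 < k
        · simpa only [s, if_pos h] using hζ j h.2
        · simp only [s, if_neg h, Finset.mem_singleton]
    have hproj : ∀ g : Funs L m n, P.info (fcInput w z₀ (hybrid k ζ g)) ℓ hℓ i =
        P.info (fcInput w₀ s.1 (hybrid k s.2 g)) ℓ hℓ i := by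
      intro g
      refine P.info_congr ℓ hℓ i fun j hij => fcInput_congr j ?_ ?_ ?_
      · intro h; have : i.1 ≤ j.1 := hij; omega
      · intro h
        have : i.1 ≤ j.1 := hij
        exact (if_pos (by omega : i.1 = 1)).symm
      · intro q hq
        have : i.1 ≤ j.1 := hij
        unfold hybrid
        split_ifs with h
        · exact (if_pos ⟨by omega, h⟩).symm
        · rfl
    rw [hproj f, hproj f']
    refine P.info_eq_of_transcript_eq ℓ hℓ i ?_ ?_
    · refine fcInput_congr i (fun _ => rfl) (fun _ => rfl) fun q hq => ?_
      unfold hybrid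
      rw [if_pos (by omega), if_pos (by omega)]
    · exact congrFun (congrFun (hconst f hf f' hf') ⟨i, hi1, hik⟩) ⟨s, hs⟩
  · rw [Fintype.card_pi]
    have hone : ∀ i : {i : Fin (L + 2) // 1 ≤ i.1 ∧ i.1 ≤ k + 1},
        Fintype.card (S i.1 → Fin ℓ → {j : Fin (L + 2) // i.1 < j} → Msg B (fcTokens L m n i.1)) ≤
          2 ^ (L * ((L + 2) * (2 * B)) * M) := by
      intro i
      rw [Fintype.card_fun, Fintype.card_fun, Fintype.card_fin, Fintype.card_coe]
      refine (Nat.pow_le_pow_left (Nat.pow_le_pow_left (card_messages_le _ _ _ _) _) _).trans ?_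
      rw [← pow_mul, ← pow_mul]
      refine Nat.pow_le_pow_right (by norm_num) ?_
      calc (L + 2) * (2 * B * fcTokens L m n i.1) * (ℓ * (S i.1).card)
          = ℓ * ((L + 2) * (2 * B)) * ((S i.1).card * fcTokens L m n i.1) := by ring
        _ ≤ L * ((L + 2) * (2 * B)) * M :=
            Nat.mul_le_mul (Nat.mul_le_mul_right _ hℓ) (hM i.1 i.2.1 i.2.2)
    refine (Finset.prod_le_pow_card _ _ _ fun i _ => hone i).trans ?_
    rw [← pow_mul, mul_comm]
    refine Nat.pow_le_pow_right (by norm_num) (Nat.mul_le_mul_right _ ?_)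
    rw [Finset.card_univ]
    simpa using Fintype.card_subtype_le fun i : Fin (L + 2) => 1 ≤ i.1 ∧ i.1 ≤ k + 1

/-- Player `-1` is made blind after one epoch at the cost of one round of messages for each query:
in this epoch only the message of player `0` depends on `z_0`, and it does not depend on `R`. -/
theorem exists_queryBlind_zero (P : FCProtocol L m n B) (hL : 0 < L) (Z₀ : Finset (Fin m))
    (Z : FunSets L m n) (R : Finset (Funs L m n)) (c : Fin m) :
    ∃ R' ⊆ R, QueryBlind P 0 1 hL Z₀ Z R' ∧
      R.card ≤ R'.card * 2 ^ ((L + 2) * (2 * B) * Fintype.card (Query L n)) := by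
  obtain ⟨R', hR', hconst, hcard⟩ := exists_large_fiber R fun f (w : Query L n) =>
    (P.info (fcInput w c f) 1 hL 0).2
  refine ⟨R', hR', ?_, hcard.trans (Nat.mul_le_mul_left _ ?_)⟩
  · intro w z₀ hz ζ hζ f hf f' hf'
    change P.info (fcInput w z₀ f) 1 hL 0 = P.info (fcInput w z₀ f') 1 hL 0
    refine Prod.ext rfl (funext fun j => ?_)
    by_cases hj : j.1.1 = 1
    · have : fcInput w z₀ f j.1 = fcInput w z₀ f' j.1 :=
        fcInput_congr j.1 (fun _ => rfl) (fun _ => rfl) fun q hq => by omega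
      change P.message 0 hL j.1 0 j.2 (fcInput w z₀ f j.1) w =
        P.message 0 hL j.1 0 j.2 (fcInput w z₀ f' j.1) w
      rw [this]
    · have hpos : 0 < j.1.1 := j.2
      have h : ∀ g : Funs L m n, fcInput w z₀ g j.1 = fcInput w c g j.1 := fun g =>
        fcInput_congr j.1 (fun _ => rfl) (fun h => absurd h hj) fun q hq => rfl
      change P.message 0 hL j.1 0 j.2 (fcInput w z₀ f j.1) w =
        P.message 0 hL j.1 0 j.2 (fcInput w z₀ f' j.1) w
      rw [h f, h f']
      exact congrFun (congrFun (hconst f hf f' hf') w) j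
  · rw [Fintype.card_fun, pow_mul]
    refine Nat.pow_le_pow_left ((card_messages_le L B 1 0).trans ?_) _
    exact Nat.pow_le_pow_right (by norm_num) (by simp)

/-- Before any communication player `0` knows only `z_0`. -/
theorem prefixBlind_zero (P : FCProtocol L m n B) (Z₀ : Finset (Fin m))
    (Z : FunSets L m n) (R : Finset (Funs L m n)) :
    PrefixBlind P 0 0 (Nat.zero_le _) Z₀ Z R :=
  fun _ _ _ _ _ _ _ _ _ i hi1 hik =>
    fcInput_congr i (fun _ => rfl) (fun _ => rfl) fun q hq => by omega

/-- The prefixes `(w, z_0, ζ)` with functions from `Z` before position `k` and fixed functions from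
there on. -/
def queryPrefixes (k : ℕ) (Z₀ : Finset (Fin m)) (Z : FunSets L m n) :
    Finset (Query L n × Fin m × Funs L m n) :=
  Finset.univ ×ˢ Z₀ ×ˢ Fintype.piFinset fun j : Fin L => if j.1 < k then Z j else {id}

open Classical in
/-- Player `-1`, blind to everything from position `k` on, hears in the next epoch nothing new from
the players `0, …, k + 1` if these are blind to everything from position `k + 1` on, and what it
hears from the later players does not depend on `z_{k+1}`.  So one more position costs one
round of messages for each query and each prefix up to position `k`. -/
theorem exists_queryBlind_succ (P : FCProtocol L m n B) (k : Fin L) (hk : k.1 + 1 < L)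
    (Z₀ : Finset (Fin m)) (Z : FunSets L m n) (R R₁ : Finset (Funs L m n))
    (hR₁ : ∀ f ∈ R₁, ∀ z ∈ Z k, Function.update f k z ∈ R) (hZ : (Z k).Nonempty)
    (hQ : QueryBlind P k.1 (k.1 + 1) k.2 Z₀ Z R)
    (hP : PrefixBlind P (k.1 + 1) (k.1 + 1) k.2 Z₀ Z R₁) :
    ∃ R' ⊆ R₁, QueryBlind P (k.1 + 1) (k.1 + 2) hk Z₀ Z R' ∧
      R₁.card ≤ R'.card * 2 ^ ((L + 2) * (2 * B) * (queryPrefixes k.1 Z₀ Z).card) := by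
  obtain ⟨y, hy⟩ := hZ
  obtain ⟨R', hR', hconst, hcard⟩ := exists_large_fiber R₁
    fun f (s : queryPrefixes (L := L) (n := n) k.1 Z₀ Z) =>
      (P.info (fcInput s.1.1 s.1.2.1 (hybrid (k.1 + 1) (Function.update s.1.2.2 k y) f))
        (k.1 + 2) hk 0).2
  refine ⟨R', hR', ?_, hcard.trans (Nat.mul_le_mul_left _ ?_)⟩
  · intro w z₀ hz ζ hζ f hf f' hf'
    have hζk : ∀ j : Fin L, j.1 < k.1 → ζ j ∈ Z j := fun j hj => hζ j (by omega)
    have hself : P.info (fcInput w z₀ (hybrid (k.1 + 1) ζ f)) (k.1 + 1) k.2 0 =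
        P.info (fcInput w z₀ (hybrid (k.1 + 1) ζ f')) (k.1 + 1) k.2 0 := by
      rw [hybrid_succ, hybrid_succ]
      exact hQ w z₀ hz ζ hζk _ (hR₁ f (hR' hf) _ (hζ k (by omega))) _
        (hR₁ f' (hR' hf') _ (hζ k (by omega)))
    refine Prod.ext hself (funext fun j => ?_)
    change P.message (k.1 + 1) hk j.1 0 j.2 _ _ = P.message (k.1 + 1) hk j.1 0 j.2 _ _
    have hj0 : 1 ≤ j.1.1 := j.2
    by_cases hj : j.1.1 ≤ k.1 + 2
    · rw [hself, hP w z₀ hz ζ hζ f (hR' hf) f' (hR' hf') j.1 hj0 hj]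
    · -- The representative of the prefix among the prefixes whose messages have been fixed.
      let ξ : Funs L m n := fun i => if i.1 < k.1 then ζ i else id
      have hs : (w, z₀, ξ) ∈ queryPrefixes (L := L) (n := n) k.1 Z₀ Z := by
        refine Finset.mem_product.2 ⟨Finset.mem_univ _, Finset.mem_product.2 ⟨hz, ?_⟩⟩
        refine Fintype.mem_piFinset.2 fun i => ?_
        by_cases h : i.1 < k.1
        · simpa only [ξ, if_pos h] using hζ i (by omega)
        · simp only [ξ, if_neg h, Finset.mem_singleton]
      -- The later players see neither the prefix nor the query.
      have hlate : ∀ g : Funs L m n,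
          P.info (fcInput w z₀ (hybrid (k.1 + 1) ζ g)) (k.1 + 1) k.2 j.1 =
          P.info (fcInput w z₀ (hybrid (k.1 + 1) (Function.update ξ k y) g)) (k.1 + 1) k.2 j.1 := by
        intro g
        refine P.info_congr _ _ _ fun i hi => fcInput_congr i (fun _ => rfl) (fun _ => rfl) ?_
        intro q hq
        have : j.1.1 ≤ i.1 := hi
        unfold hybrid
        rw [if_neg (by omega), if_neg (by omega)]
      -- After `k + 1` epochs player `-1` cannot tell the value `ζ k` of `z_{k+1}` from `y`.
      have hquery : ∀ g ∈ R',
          P.info (fcInput w z₀ (hybrid (k.1 + 1) ζ g)) (k.1 + 1) k.2 0 =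
          P.info (fcInput w z₀ (hybrid (k.1 + 1) (Function.update ξ k y) g)) (k.1 + 1) k.2 0 := by
        intro g hg
        have hξ : hybrid (k.1 + 1) (Function.update ξ k y) g =
            hybrid k.1 ζ (Function.update g k y) := by
          rw [hybrid_succ, Function.update_self]
          funext i
          unfold hybrid
          split_ifs with h
          · rw [Function.update_of_ne (by rintro rfl; omega)]
            exact if_pos h
          · rfl
        rw [hξ, hybrid_succ]
        exact hQ w z₀ hz ζ hζk _ (hR₁ g (hR' hg) _ (hζ k (by omega))) _ (hR₁ g (hR' hg) _ hy)
      rw [hlate f, hlate f', hquery f hf, hquery f' hf']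
      exact congrFun (congrFun (hconst f hf f' hf') ⟨(w, z₀, ξ), hs⟩) j
  · rw [Fintype.card_fun, Fintype.card_coe, pow_mul]
    refine Nat.pow_le_pow_left ((card_messages_le L B 1 0).trans ?_) _
    exact Nat.pow_le_pow_right (by norm_num) (by simp)

open Classical in
/-- Finitely many values of `z_{k+1}`, all compatible with a dense set of continuations, under which
`A` has many images. -/
theorem exists_spread_slices (k : Fin L) (R : Finset (Funs L m n)) (A : Finset (Fin (bigN m n k.1)))
    (D t x : ℕ) (hN : 0 < bigN m n k.1) (hR : Fintype.card (Funs L m n) ≤ R.card * D)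
    (ht : t ≤ bigN m n k.1)
    (hD : 2 * D * bigN m n k.1 ^ t * ((x + 1) * t) ^ A.card < bigN m n k.1 ^ A.card) :
    ∃ g : Fin x → Fin (bigN m n k.1) → Fin (bigN m n k.1), ∃ R' : Finset (Funs L m n),
      (∀ f ∈ R', ∀ i, Function.update f k (g i) ∈ R) ∧
      x * t ≤ (Finset.univ.biUnion fun i => A.image (g i)).card ∧
      Fintype.card (Funs L m n) ≤
        R'.card * (2 * D * (bigN m n k.1 ^ bigN m n k.1) ^ x) := by
  have : Nonempty (Fin (bigN m n k.1)) := ⟨⟨0, hN⟩⟩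
  obtain ⟨G, hG, hslice⟩ := exists_dense_slices k R D hR
  have hg : ∀ f ∈ G, ∃ g : Fin x → Fin (bigN m n k.1) → Fin (bigN m n k.1),
      (∀ i, Function.update f k (g i) ∈ R) ∧
      x * t ≤ (Finset.univ.biUnion fun i => A.image (g i)).card := by
    intro f hf
    obtain ⟨C, hCR, hCd⟩ := hslice f hf
    obtain ⟨g, hgC, hgt⟩ := exists_spread
      C A (2 * D) t x hCd
      (by simpa using ht) (by simpa using hD)
    exact ⟨g, fun i => hCR _ (hgC i), hgt⟩
  choose! g hgR hgt using hg
  obtain ⟨R', hR', hconst, hcard⟩ := exists_large_fiber G g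
  have hfin : Fintype.card (Funs L m n) ≤
      R'.card * (2 * D * (bigN m n k.1 ^ bigN m n k.1) ^ x) := by
    refine hG.trans ((Nat.mul_le_mul_right _ hcard).trans_eq ?_)
    simp only [Fintype.card_fun, Fintype.card_fin]
    ring
  have hne : R'.Nonempty := by
    rw [← Finset.card_pos]
    have : ∀ k : Fin L, Nonempty (Fin (bigN m n k.1) → Fin (bigN m n k.1)) := fun _ => ⟨id⟩
    have : 0 < Fintype.card (Funs L m n) := Fintype.card_pos
    exact Nat.pos_of_mul_pos_right (this.trans_le hfin)
  obtain ⟨f₀, hf₀⟩ := hne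
  refine ⟨g f₀, R', fun f hf i => ?_, hgt f₀ (hR' hf₀), hfin⟩
  rw [hconst f₀ hf₀ f hf]
  exact hgR f (hR' hf) i

open Classical in
/-- Pairing the values at reached points of the functions in `Z k` with all the `w_{k+1}` gives
reached points for the next position. -/
theorem exists_reached_succ (k : Fin L) (hk : k.1 + 1 < L) (Z₀ : Finset (Fin m))
    (Z : FunSets L m n) (A : Finset (Fin (bigN m n k.1))) (hA : ↑A ⊆ reached k.1 k.2 Z₀ Z)
    (T : Finset (Fin (bigN m n k.1)))
    (hT : ∀ b ∈ T, ∃ z ∈ Z k, ∃ a ∈ A, z a = b) :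
    ∃ A' : Finset (Fin (bigN m n (k.1 + 1))), A'.card = n (k.1 + 1) * T.card ∧
      ↑A' ⊆ reached (k.1 + 1) hk Z₀ Z := by
  refine ⟨(Finset.univ ×ˢ T).image fun p : Fin (n (k.1 + 1)) × Fin (bigN m n k.1) =>
    pair m n k.1 p.1 p.2, ?_, ?_⟩
  · rw [Finset.card_image_of_injective _ (pair_injective2 m n k.1), Finset.card_product,
      Finset.card_univ, Fintype.card_fin]
  · intro a' ha'
    obtain ⟨⟨v, b⟩, hvb, rfl⟩ := Finset.mem_image.1 (Finset.mem_coe.1 ha')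
    obtain ⟨z, hz, a, ha, rfl⟩ := hT b (Finset.mem_product.1 hvb).2
    obtain ⟨w, z₀, hz₀, ζ, hζ, rfl⟩ := hA ha
    refine ⟨Function.update w ⟨k.1, by omega⟩ v, z₀, hz₀, Function.update ζ k z, ?_, ?_⟩
    · intro j hj
      by_cases h : j = k
      · subst h; rwa [Function.update_self]
      · rw [Function.update_of_ne h]
        exact hζ j (by have := fun h' => h (Fin.ext h'); omega)
    · rw [compArg, Function.update_self, Function.update_self]
      congr 2
      refine compArg_congr _ _ (fun j hj => ?_) fun j hj => ?_
      · rw [Function.update_of_ne (by rintro rfl; exact lt_irrefl _ hj)]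
      · rw [Function.update_of_ne (by rintro rfl; exact lt_irrefl _ hj)]

/-- If player `-1` is blind to `z_L` at the end, it gives the same answer for two functions in `R`
that differ at a reached point. -/
theorem not_solves_of_queryBlind (hL : 1 ≤ L) (P : FCProtocol L m n B) (Z₀ : Finset (Fin m))
    (Z : FunSets L m n) (R : Finset (Funs L m n)) (k : Fin L) (hk : k.1 = L - 1)
    (A : Finset (Fin (bigN m n k.1))) (D : ℕ)
    (hN : 0 < bigN m n k.1) (hA : ↑A ⊆ reached k.1 k.2 Z₀ Z)
    (hQ : QueryBlind P k.1 (k.1 + 1) k.2 Z₀ Z R)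
    (hR : Fintype.card (Funs L m n) ≤ R.card * D) (hD : 2 * D < bigN m n k.1 ^ A.card) :
    ¬ SolvesFuncComp hL P := by
  intro hsol
  have : Nonempty (Fin (bigN m n k.1)) := ⟨⟨0, hN⟩⟩
  obtain ⟨G, hG, hslice⟩ := exists_dense_slices k R D hR
  have : ∀ k : Fin L, Nonempty (Fin (bigN m n k.1) → Fin (bigN m n k.1)) := fun _ => ⟨id⟩
  have hpos : 0 < Fintype.card (Funs L m n) := Fintype.card_pos
  obtain ⟨f, hf⟩ := Finset.card_pos.1 (Nat.pos_of_mul_pos_right (hpos.trans_le hG))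
  obtain ⟨C, hCR, hCd⟩ := hslice f hf
  obtain ⟨z, hz, z', hz', a, ha, hne⟩ := exists_ne_of_dense C A (2 * D) hCd
    (by simpa using hD)
  obtain ⟨w, z₀, hz₀, ζ, hζ, harg⟩ := hA ha
  have hinfo := hQ w z₀ hz₀ ζ hζ _ (hCR z hz) _ (hCR z' hz')
  have hval : ∀ y : Fin (bigN m n k.1) → Fin (bigN m n k.1),
      partialComp w z₀ (hybrid k.1 ζ (Function.update f k y)) k.1 k.2 = y a := by
    intro y
    rw [partialComp_eq]
    have h1 : compArg w z₀ (hybrid k.1 ζ (Function.update f k y)) k.1 k.2 = a := by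
      rw [← harg]
      exact compArg_congr _ _ (fun _ _ => rfl) fun j hj => if_pos hj
    rw [h1]
    have h2 : hybrid k.1 ζ (Function.update f k y) k = y := by
      unfold hybrid
      rw [if_neg (lt_irrefl _), Function.update_self]
    exact congrFun h2 a
  apply hne
  rw [← hval z, ← hval z']
  obtain ⟨k, hkL⟩ := k
  obtain rfl : k = L - 1 := hk
  obtain ⟨l, rfl⟩ : ∃ l, L = l + 1 := ⟨L - 1, by omega⟩
  have h1 := hsol w z₀ (hybrid l ζ (Function.update f ⟨l, hkL⟩ z))
  have h2 := hsol w z₀ (hybrid l ζ (Function.update f ⟨l, hkL⟩ z'))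
  have h3 := congrArg P.output hinfo
  exact h1.symm.trans (h3.trans h2)

end Indistinguishable

/-! ### Parameters and the induction -/

section Parameters

theorem bigN_eq_of_pow {m : ℕ} {n X : ℕ → ℕ} (hn : ∀ j, n (j + 1) = X j ^ 4) (k : ℕ) :
    bigN m n k = m * (∏ j ∈ Finset.range k, X j) ^ 4 := by
  induction k with
  | zero => simp [bigN]
  | succ k ih => rw [← bigN_succ, ih, hn, Finset.prod_range_succ]; ring

/-- The quantities steering the construction: `Y` values of `z_0` and at most `X_j` values of
`z_{j+1}` are kept, and all domains have at most `K ^ e` points.  In each step the number of reached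
points falls short of the largest conceivable one by a factor `4 * e`.  The two budgets bound the
loss of density by the messages to the players from `0` on and by those to player `-1`. -/
structure Regime (L m B : ℕ) (n X : ℕ → ℕ) (K Y e : ℕ) : Prop where
  two_le_K : 2 ≤ K
  e_pos : 0 < e
  Y_pos : 0 < Y
  X_pos : ∀ j, 0 < X j
  m_eq : m = K * Y * ∏ j ∈ Finset.range (L - 1), X j
  n_eq : ∀ j, n (j + 1) = X j ^ 4
  X_ge : ∀ k, k + 1 < L → (∏ j ∈ Finset.Ico (k + 1) (L - 1), X j) ^ 4 * K ≤ X k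
  Y_ge : (∏ j ∈ Finset.range (L - 1), X j) ^ 4 * K ≤ Y
  dvd_Y : (4 * e) ^ L ∣ Y
  bigN_le : ∀ k, k < L → bigN m n k ≤ K ^ e
  prefix_budget : ∀ k, k + 1 < L →
    8 * (4 * e) ^ (k + 1) * (K * e + (L + 2) * (L * ((L + 2) * (2 * B))) + 2) ≤ K ^ 2
  query_budget : ∀ k, k < L → 16 * (4 * e) ^ k * ((L + 2) * B) ≤ K

/-- The number of reached points secured for position `k`. -/
def reachCount (X : ℕ → ℕ) (Y e k : ℕ) : ℕ :=
  Y * (∏ j ∈ Finset.range k, X j) ^ 5 / (4 * e) ^ k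

namespace Regime

variable {L m B K Y e : ℕ} {n X : ℕ → ℕ}

theorem bigN_eq (h : Regime L m B n X K Y e) (k : ℕ) :
    bigN m n k = m * (∏ j ∈ Finset.range k, X j) ^ 4 := bigN_eq_of_pow h.n_eq k

theorem prod_pos (h : Regime L m B n X K Y e) (s : Finset ℕ) : 0 < ∏ j ∈ s, X j :=
  Finset.prod_pos fun j _ => h.X_pos j

theorem reachCount_mul (h : Regime L m B n X K Y e) {k : ℕ} (hk : k ≤ L) :
    reachCount X Y e k * (4 * e) ^ k = Y * (∏ j ∈ Finset.range k, X j) ^ 5 :=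
  Nat.div_mul_cancel (((pow_dvd_pow _ hk).trans h.dvd_Y).mul_right _)

theorem dvd_reachCount (h : Regime L m B n X K Y e) {k : ℕ} (hk : k < L) :
    4 * e ∣ reachCount X Y e k := by
  have hpos : 0 < (4 * e) ^ k := pow_pos (by have := h.e_pos; omega) _
  refine Nat.dvd_of_mul_dvd_mul_right hpos ?_
  rw [h.reachCount_mul hk.le, ← pow_succ']
  exact ((pow_dvd_pow _ hk).trans h.dvd_Y).mul_right _

theorem reachCount_pos (h : Regime L m B n X K Y e) {k : ℕ} (hk : k ≤ L) :
    0 < reachCount X Y e k := by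
  have h1 : 0 < Y * (∏ j ∈ Finset.range k, X j) ^ 5 :=
    Nat.mul_pos h.Y_pos (pow_pos (h.prod_pos _) _)
  rw [← h.reachCount_mul hk] at h1
  exact Nat.pos_of_mul_pos_right h1

theorem four_le_reachCount (h : Regime L m B n X K Y e) {k : ℕ} (hk : k < L) :
    4 ≤ reachCount X Y e k := by
  have h1 := Nat.le_of_dvd (h.reachCount_pos hk.le) (h.dvd_reachCount hk)
  have := h.e_pos
  omega

theorem reachCount_le (X : ℕ → ℕ) (Y e k : ℕ) :
    reachCount X Y e k ≤ Y * (∏ j ∈ Finset.range k, X j) ^ 5 := Nat.div_le_self _ _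

theorem reachCount_succ (h : Regime L m B n X K Y e) {k : ℕ} (hk : k < L) :
    reachCount X Y e (k + 1) = n (k + 1) * (X k * (reachCount X Y e k / (4 * e))) := by
  have he : 0 < (4 * e) ^ (k + 1) := pow_pos (by have := h.e_pos; omega) _
  refine Nat.eq_of_mul_eq_mul_right he ?_
  rw [h.reachCount_mul hk, h.n_eq, Finset.prod_range_succ]
  obtain ⟨t, ht⟩ := h.dvd_reachCount hk
  have h1 := h.reachCount_mul hk.le
  rw [ht] at h1
  rw [ht, Nat.mul_div_cancel_left _ (by have := h.e_pos; omega)]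
  rw [mul_pow, ← mul_assoc, ← h1]
  ring

theorem prod_range_eq {k : ℕ} (X : ℕ → ℕ) (hk : k + 1 < L) :
    ∏ j ∈ Finset.range (L - 1), X j =
      (∏ j ∈ Finset.range k, X j) * X k * ∏ j ∈ Finset.Ico (k + 1) (L - 1), X j := by
  rw [← Finset.prod_range_succ, Finset.prod_range_mul_prod_Ico _ (by omega)]

theorem reachCount_mul_le (h : Regime L m B n X K Y e) {k : ℕ} (hk : k + 1 < L) :
    reachCount X Y e k * X k * K ≤ bigN m n k := by
  have hV := h.prod_pos (Finset.Ico (k + 1) (L - 1))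
  rw [h.bigN_eq, h.m_eq, prod_range_eq X hk]
  set P := ∏ j ∈ Finset.range k, X j
  set V := ∏ j ∈ Finset.Ico (k + 1) (L - 1), X j
  calc reachCount X Y e k * X k * K ≤ Y * P ^ 5 * X k * K :=
        Nat.mul_le_mul_right _ (Nat.mul_le_mul_right _ (reachCount_le X Y e k))
    _ ≤ Y * P ^ 5 * X k * K * V := Nat.le_mul_of_pos_right _ hV
    _ = K * Y * (P * X k * V) * P ^ 4 := by ring

theorem m_le_bigN (h : Regime L m B n X K Y e) (k : ℕ) : m ≤ bigN m n k := by
  rw [h.bigN_eq]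
  exact Nat.le_mul_of_pos_right _ (pow_pos (h.prod_pos _) _)

theorem K_le_m (h : Regime L m B n X K Y e) : K ≤ m := by
  rw [h.m_eq, mul_assoc]
  exact Nat.le_mul_of_pos_right _ (Nat.mul_pos h.Y_pos (h.prod_pos _))

theorem bigN_pos (h : Regime L m B n X K Y e) (k : ℕ) : 0 < bigN m n k := by
  have := h.m_le_bigN k
  have := h.K_le_m
  have := h.two_le_K
  omega

theorem Y_mul_prod_le_m (h : Regime L m B n X K Y e) {k : ℕ} (hk : k + 1 < L) :
    Y * ∏ j ∈ Finset.range (k + 1), X j ≤ m := by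
  rw [h.m_eq, mul_assoc]
  refine le_trans (Nat.mul_le_mul_left _ ?_) (Nat.le_mul_of_pos_left _ ?_)
  · exact Finset.prod_le_prod_of_subset_of_one_le' (Finset.range_subset_range.2 (by omega))
      fun j _ _ => h.X_pos j
  · have := h.two_le_K; omega

/-- The number of prefixes visible to player `q + 1` times the length of its input is at most the
length of the input of player `k + 1` times the number of its values. -/
theorem prod_mul_bigN_le (h : Regime L m B n X K Y e) {q k : ℕ} (hq : q ≤ k) :
    (∏ j ∈ Finset.Ico q (k + 1), X j) * bigN m n q ≤ bigN m n k * X k := by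
  rw [h.bigN_eq, h.bigN_eq, Finset.prod_Ico_succ_top hq,
    ← Finset.prod_range_mul_prod_Ico (fun j => X j) hq]
  have hV := h.prod_pos (Finset.Ico q k)
  set V := ∏ j ∈ Finset.Ico q k, X j
  set P := ∏ j ∈ Finset.range q, X j
  calc V * X k * (m * P ^ 4) = m * P ^ 4 * V * X k := by ring
    _ ≤ m * P ^ 4 * V ^ 4 * X k :=
        Nat.mul_le_mul_right _ (Nat.mul_le_mul_left _ (Nat.le_self_pow (by norm_num) V))
    _ = m * (P * V) ^ 4 * X k := by ring

/-- The density lost in one step is small compared with the number of reached points: the terms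
are the loss so far, the halving of the density on slices, the choice of the values of `z_{k+1}`,
the messages to the players `0, …, k + 1`, and the messages to player `-1`. -/
theorem step_budget (h : Regime L m B n X K Y e) {k Δ : ℕ} (hk : k + 1 < L)
    (hΔ : 4 * Δ ≤ reachCount X Y e k) :
    4 * (Δ + 1 + K * e * (bigN m n k * X k) +
      (L + 2) * (L * ((L + 2) * (2 * B)) * (bigN m n k * X k)) +
      (L + 2) * (2 * B) * ((∏ j ∈ Finset.range (L - 1), X j) ^ 4 *
        (Y * ∏ j ∈ Finset.range k, X j))) ≤ reachCount X Y e (k + 1) := by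
  have hE : 0 < (4 * e) ^ (k + 1) := pow_pos (by have := h.e_pos; omega) _
  have hr := h.reachCount_mul hk.le
  have hb1 := h.prefix_budget k hk
  have hb2 := h.query_budget (k + 1) hk
  have hX := h.X_ge k hk
  have hNx : 1 ≤ bigN m n k * X k := Nat.mul_pos (h.bigN_pos k) (h.X_pos k)
  have hΔN : Δ + 1 ≤ 2 * (bigN m n k * X k) := by
    have h1 := h.reachCount_mul_le hk
    have h2 : reachCount X Y e k ≤ reachCount X Y e k * X k * K := by
      rw [mul_assoc]
      refine Nat.le_mul_of_pos_right _ (Nat.mul_pos (h.X_pos k) ?_)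
      have := h.two_le_K; omega
    have h3 : bigN m n k ≤ bigN m n k * X k := Nat.le_mul_of_pos_right _ (h.X_pos k)
    omega
  have hN : bigN m n k * X k = K * Y * (∏ j ∈ Finset.range k, X j) ^ 5 * X k ^ 2 *
      ∏ j ∈ Finset.Ico (k + 1) (L - 1), X j := by
    rw [h.bigN_eq, h.m_eq, prod_range_eq X hk]; ring
  rw [prod_range_eq X hk]
  rw [Finset.prod_range_succ] at hr
  have hV := h.prod_pos (Finset.Ico (k + 1) (L - 1))
  set P := ∏ j ∈ Finset.range k, X j
  set V := ∏ j ∈ Finset.Ico (k + 1) (L - 1), X j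
  set E := (4 * e) ^ (k + 1)
  set x := X k
  set M := bigN m n k * x
  set r' := reachCount X Y e (k + 1)
  have hVK : V * K ≤ x := (Nat.mul_le_mul_right _ (Nat.le_self_pow (by norm_num) V)).trans hX
  have hKx : K ≤ x := (Nat.le_mul_of_pos_left K hV).trans hVK
  have h1 : 8 * ((K * e + (L + 2) * (L * ((L + 2) * (2 * B))) + 2) * M) ≤ r' := by
    refine Nat.le_of_mul_le_mul_right ?_ hE
    calc 8 * ((K * e + (L + 2) * (L * ((L + 2) * (2 * B))) + 2) * M) * E
        = 8 * E * (K * e + (L + 2) * (L * ((L + 2) * (2 * B))) + 2) * (V * K) *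
            (Y * P ^ 5 * x ^ 2) := by rw [hN]; ring
      _ ≤ x ^ 2 * x * (Y * P ^ 5 * x ^ 2) :=
          Nat.mul_le_mul_right _ (Nat.mul_le_mul (hb1.trans (Nat.pow_le_pow_left hKx 2)) hVK)
      _ = r' * E := by rw [hr]; ring
  have h2 : 8 * ((L + 2) * (2 * B) * ((P * x * V) ^ 4 * (Y * P))) ≤ r' := by
    refine Nat.le_of_mul_le_mul_right ?_ hE
    calc 8 * ((L + 2) * (2 * B) * ((P * x * V) ^ 4 * (Y * P))) * E
        = V ^ 4 * (16 * E * ((L + 2) * B)) * (Y * P ^ 5 * x ^ 4) := by ring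
      _ ≤ x * (Y * P ^ 5 * x ^ 4) :=
          Nat.mul_le_mul_right _ ((Nat.mul_le_mul_left _ hb2).trans hX)
      _ = r' * E := by rw [hr]; ring
  have h3 : Δ + 1 + K * e * M + (L + 2) * (L * ((L + 2) * (2 * B)) * M) ≤
      (K * e + (L + 2) * (L * ((L + 2) * (2 * B))) + 2) * M := by
    have : (K * e + (L + 2) * (L * ((L + 2) * (2 * B))) + 2) * M = 2 * M + K * e * M +
        (L + 2) * (L * ((L + 2) * (2 * B)) * M) := by ring
    omega
  omega

/-- The hypothesis under which the greedy choice in `exists_spread` succeeds: the images found have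
to fill only a fraction `1 / K` of the domain. -/
theorem spread_budget (h : Regime L m B n X K Y e) {k Δ : ℕ} (hk : k + 1 < L)
    (hΔ : 4 * Δ ≤ reachCount X Y e k) :
    2 * 2 ^ Δ * bigN m n k ^ (reachCount X Y e k / (4 * e)) *
      ((X k + 1) * (reachCount X Y e k / (4 * e))) ^ reachCount X Y e k <
      bigN m n k ^ reachCount X Y e k := by
  have he := h.e_pos
  have h4 := h.four_le_reachCount (by omega : k < L)
  obtain ⟨t, ht⟩ := h.dvd_reachCount (by omega : k < L)
  have hNr := h.reachCount_mul_le hk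
  rw [show reachCount X Y e k / (4 * e) = t by rw [ht, Nat.mul_div_cancel_left _ (by omega)]]
  set r := reachCount X Y e k
  have htpos : 0 < t := by
    rcases Nat.eq_zero_or_pos t with rfl | h0
    · rw [mul_zero] at ht; omega
    · exact h0
  have hK := h.two_le_K
  have h1 : 2 * 2 ^ Δ * bigN m n k ^ t ≤ K ^ (Δ + 1 + e * t) := by
    rw [pow_add, pow_mul, ← pow_succ']
    exact Nat.mul_le_mul (Nat.pow_le_pow_left hK _)
      (Nat.pow_le_pow_left (h.bigN_le k (by omega)) _)
  have h2 : Δ + 1 + e * t < r := by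
    have : r = 4 * (e * t) := by rw [ht]; ring
    omega
  have h3 : (X k + 1) * t * K ≤ bigN m n k := by
    refine le_trans (Nat.mul_le_mul_right _ ?_) hNr
    have hx := h.X_pos k
    calc (X k + 1) * t ≤ (X k * 4) * t := Nat.mul_le_mul_right _ (by omega)
      _ = 4 * 1 * t * X k := by ring
      _ ≤ 4 * e * t * X k := Nat.mul_le_mul_right _ (Nat.mul_le_mul_right _
          (Nat.mul_le_mul_left _ he))
      _ = r * X k := by rw [ht]
  calc 2 * 2 ^ Δ * bigN m n k ^ t * ((X k + 1) * t) ^ r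
      ≤ K ^ (Δ + 1 + e * t) * ((X k + 1) * t) ^ r := Nat.mul_le_mul_right _ h1
    _ < K ^ r * ((X k + 1) * t) ^ r := by
        refine Nat.mul_lt_mul_of_pos_right (Nat.pow_lt_pow_right (by omega) h2) (pow_pos ?_ _)
        exact Nat.mul_pos (Nat.succ_pos _) htpos
    _ = ((X k + 1) * t * K) ^ r := by rw [← mul_pow, mul_comm]
    _ ≤ bigN m n k ^ r := Nat.pow_le_pow_left h3 _

end Regime
end Parameters

section Induction

variable {L m B K Y e : ℕ} {n X : ℕ → ℕ}

theorem card_query (h : Regime L m B n X K Y e) :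
    Fintype.card (Query L n) = (∏ j ∈ Finset.range (L - 1), X j) ^ 4 := by
  rw [Fintype.card_pi]
  simp only [Fintype.card_fin, h.n_eq]
  rw [Finset.prod_pow, Fin.prod_univ_eq_prod_range (fun j => X j)]

/-- Number of prefixes that use the given sets at the positions in `[q, k)` and are fixed
elsewhere. -/
theorem card_piFinset_le (Z : FunSets L m n) (X : ℕ → ℕ) {k : ℕ} (q : ℕ) (hk : k ≤ L)
    (c : Fin L → Prop) [DecidablePred c] (hc : ∀ j, c j ↔ q ≤ j.1 ∧ j.1 < k)
    (hZ : ∀ j : Fin L, j.1 < k → (Z j).card ≤ X j) :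
    (Fintype.piFinset fun j : Fin L => if c j then Z j else {id}).card ≤
      ∏ j ∈ Finset.Ico q k, X j := by
  rw [Fintype.card_piFinset]
  calc ∏ j : Fin L, (if c j then Z j else {id}).card
      ≤ ∏ j : Fin L, (if q ≤ j.1 ∧ j.1 < k then X j else 1) := by
        refine Finset.prod_le_prod' fun j _ => ?_
        by_cases h : c j
        · rw [if_pos h, if_pos ((hc j).1 h)]
          exact hZ j ((hc j).1 h).2
        · rw [if_neg h, if_neg (fun h' => h ((hc j).2 h')), Finset.card_singleton]
    _ = ∏ j ∈ Finset.Ico q k, X j := by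
        rw [Fin.prod_univ_eq_prod_range (fun j => if q ≤ j ∧ j < k then X j else 1) L,
          ← Finset.prod_filter]
        refine Finset.prod_congr ?_ fun _ _ => rfl
        ext j
        simp only [Finset.mem_filter, Finset.mem_range, Finset.mem_Ico]
        omega

/-- The number of message bits to be fixed for each of the players `0, …, k + 1` is, up to the factor
common to all of them, at most `bigN m n k * X k`. -/
theorem card_visiblePrefixes_mul_le (h : Regime L m B n X K Y e) {k : ℕ} (hk : k + 1 < L)
    (Z₀ : Finset (Fin m)) (hZ₀ : Z₀.card = Y) (Z : FunSets L m n)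
    (hZ : ∀ j : Fin L, j.1 < k + 1 → (Z j).card ≤ X j) (c : Fin m) (i : Fin (L + 2))
    (hi1 : 1 ≤ i.1) (hik : i.1 ≤ k + 2) :
    (visiblePrefixes (k + 1) Z₀ Z c i).card * fcTokens L m n i ≤ bigN m n k * X k := by
  have hle := card_piFinset_le Z X (i.1 - 2) (by omega : k + 1 ≤ L)
    (fun j => i.1 ≤ j.1 + 2 ∧ j.1 < k + 1) (fun j => by omega) hZ
  unfold visiblePrefixes
  rw [Finset.card_product]
  obtain ⟨i, hi⟩ := i
  match i, hi with
  | 1, _ =>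
    change _ * 1 ≤ _
    rw [if_pos rfl, hZ₀, mul_one]
    refine (Nat.mul_le_mul_left _ hle).trans ?_
    change Y * ∏ j ∈ Finset.Ico 0 (k + 1), X j ≤ _
    rw [← Finset.range_eq_Ico]
    exact (h.Y_mul_prod_le_m hk).trans ((h.m_le_bigN k).trans
      (Nat.le_mul_of_pos_right _ (h.X_pos k)))
  | q + 2, _ =>
    change _ * bigN m n q ≤ _
    rw [if_neg (by simp), Finset.card_singleton, one_mul]
    have hqk : q + 2 ≤ k + 2 := hik
    exact (Nat.mul_le_mul_right _ hle).trans (h.prod_mul_bigN_le (by omega))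

theorem card_queryPrefixes_le (h : Regime L m B n X K Y e) {k : ℕ} (hk : k < L)
    (Z₀ : Finset (Fin m)) (hZ₀ : Z₀.card = Y) (Z : FunSets L m n)
    (hZ : ∀ j : Fin L, j.1 < k → (Z j).card ≤ X j) :
    (queryPrefixes (L := L) (n := n) k Z₀ Z).card ≤
      (∏ j ∈ Finset.range (L - 1), X j) ^ 4 * (Y * ∏ j ∈ Finset.range k, X j) := by
  unfold queryPrefixes
  rw [Finset.card_product, Finset.card_product, Finset.card_univ, card_query h, hZ₀]
  refine Nat.mul_le_mul_left _ (Nat.mul_le_mul_left _ ?_)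
  rw [Finset.range_eq_Ico]
  exact card_piFinset_le Z X 0 hk.le (fun j => j.1 < k) (fun j => by omega) hZ

open Classical in
/-- For each `k < L` there are a few prefixes reaching many points at position `k`, and a dense set
of continuations between which, with these prefixes, players `0, …, k` cannot distinguish after
`k` epochs and player `-1` cannot distinguish after `k + 1` epochs. -/
theorem exists_blind (h : Regime L m B n X K Y e) (P : FCProtocol L m n B)
    (Z₀ : Finset (Fin m)) (hZ₀ : Z₀.card = Y) (k : ℕ) (hk : k < L) :
    ∃ (Z : FunSets L m n) (R : Finset (Funs L m n)) (A : Finset (Fin (bigN m n k))) (Δ : ℕ),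
      (∀ j : Fin L, j.1 < k → (Z j).card ≤ X j) ∧ PrefixBlind P k k hk.le Z₀ Z R ∧
      QueryBlind P k (k + 1) hk Z₀ Z R ∧ A.card = reachCount X Y e k ∧
      ↑A ⊆ reached k hk Z₀ Z ∧ Fintype.card (Funs L m n) ≤ R.card * 2 ^ Δ ∧
      4 * Δ ≤ reachCount X Y e k := by
  have hmpos : 0 < m := by have := h.K_le_m; have := h.two_le_K; omega
  let c : Fin m := ⟨0, hmpos⟩
  let w₀ : Query L n := fun j => ⟨0, by rw [h.n_eq]; exact pow_pos (h.X_pos _) _⟩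
  induction k with
  | zero =>
    obtain ⟨R, -, hQ, hR⟩ := exists_queryBlind_zero P hk Z₀ (fun _ => ∅) Finset.univ c
    refine ⟨fun _ => ∅, R, Z₀.image (Fin.cast (bigN_zero m n)), _, fun j hj => by omega,
      prefixBlind_zero P _ _ _, hQ, ?_, ?_, hR, ?_⟩
    · rw [Finset.card_image_of_injective _ (Fin.cast_injective _), hZ₀]
      simp [reachCount]
    · intro a ha
      obtain ⟨z₀, hz₀, rfl⟩ := Finset.mem_image.1 (Finset.mem_coe.1 ha)
      exact ⟨w₀, z₀, hz₀, fun _ => id, fun j hj => absurd hj (by omega), rfl⟩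
    · have h1 := h.query_budget 0 hk
      have h2 := h.Y_ge
      rw [card_query h]
      simp only [reachCount, Finset.range_zero, Finset.prod_empty, one_pow, mul_one, pow_zero,
        Nat.div_one] at h1 ⊢
      refine le_trans ?_ h2
      calc 4 * ((L + 2) * (2 * B) * (∏ j ∈ Finset.range (L - 1), X j) ^ 4)
          = (∏ j ∈ Finset.range (L - 1), X j) ^ 4 * (8 * ((L + 2) * B)) := by ring
        _ ≤ _ := Nat.mul_le_mul_left _ (by omega)
  | succ k ih =>
    obtain ⟨Z, R, A, Δ, hZ, -, hQ, hAc, hA, hR, hΔ⟩ := ih (by omega)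
    let κ : Fin L := ⟨k, by omega⟩
    set t := reachCount X Y e k / (4 * e) with ht
    have htN : t ≤ bigN m n k := by
      refine le_trans (Nat.div_le_self _ _) (le_trans ?_ (h.reachCount_mul_le hk))
      rw [mul_assoc]
      refine Nat.le_mul_of_pos_right _ (Nat.mul_pos (h.X_pos k) ?_)
      have := h.two_le_K; omega
    obtain ⟨g, R₁, hgR, hgt, hR₁⟩ := exists_spread_slices κ R A (2 ^ Δ) t (X k) (h.bigN_pos k) hR
      htN (by rw [hAc]; exact h.spread_budget hk hΔ)
    -- From here on the values of `z_{k+1}` are confined to those just chosen.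
    set Z' : FunSets L m n := Function.update Z κ (Finset.univ.image g) with hZ'def
    have hZ'κ : Z' κ = Finset.univ.image g := by rw [hZ'def, Function.update_self]
    have hZ'lt : ∀ j : Fin L, j.1 < k → Z' j = Z j := fun j hj => by
      rw [hZ'def, Function.update_of_ne (by rintro rfl; exact lt_irrefl _ hj)]
    have hZ' : ∀ j : Fin L, j.1 < k + 1 → (Z' j).card ≤ X j := by
      intro j hj
      rcases Nat.lt_succ_iff_lt_or_eq.1 hj with hlt | heq
      · rw [hZ'lt j hlt]; exact hZ j hlt
      · obtain rfl : j = κ := Fin.ext heq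
        rw [hZ'κ]
        exact Finset.card_image_le.trans (by simp [κ])
    have hQ' : QueryBlind P k (k + 1) (by omega) Z₀ Z' R := fun w z₀ hz ζ hζ =>
      hQ w z₀ hz ζ fun j hj => by rw [← hZ'lt j hj]; exact hζ j hj
    have hA' : ↑A ⊆ reached k (by omega) Z₀ Z' := by
      intro a ha
      obtain ⟨w, z₀, hz, ζ, hζ, rfl⟩ := hA ha
      exact ⟨w, z₀, hz, ζ, fun j hj => by rw [hZ'lt j hj]; exact hζ j hj, rfl⟩
    obtain ⟨R₂, hR₂₁, hP₂, hR₂⟩ := exists_prefixBlind P (k + 1) (k + 1) hk.le Z₀ Z' R₁ w₀ c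
      (bigN m n k * X k) fun i hi1 hik =>
        card_visiblePrefixes_mul_le h hk Z₀ hZ₀ Z' hZ' c i hi1 hik
    have hne : (Z' κ).Nonempty := by
      rw [hZ'κ]
      exact ⟨g ⟨0, h.X_pos k⟩, Finset.mem_image_of_mem _ (Finset.mem_univ _)⟩
    obtain ⟨R₃, hR₃₂, hQ₃, hR₃⟩ := exists_queryBlind_succ P κ hk Z₀ Z' R R₂
      (fun f hf z hz => by
        rw [hZ'κ] at hz
        obtain ⟨i, -, rfl⟩ := Finset.mem_image.1 hz
        exact hgR f (hR₂₁ hf) i) hne hQ' hP₂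
    obtain ⟨T, hTsub, hTc⟩ := Finset.exists_subset_card_eq hgt
    obtain ⟨A', hA'c, hA'r⟩ := exists_reached_succ κ hk Z₀ Z' A hA' T fun b hb => by
      obtain ⟨i, -, hi⟩ := Finset.mem_biUnion.1 (hTsub hb)
      obtain ⟨a, ha, rfl⟩ := Finset.mem_image.1 hi
      exact ⟨g i, by rw [hZ'κ]; exact Finset.mem_image_of_mem _ (Finset.mem_univ _), a, ha, rfl⟩
    refine ⟨Z', R₃, A', _, hZ', hP₂.mono hR₃₂, hQ₃, ?_, hA'r, ?_, h.step_budget hk hΔ⟩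
    · rw [hA'c, hTc, h.reachCount_succ (by omega)]
    · have hpow : (bigN m n k ^ bigN m n k) ^ X k ≤ 2 ^ (K * e * (bigN m n k * X k)) := by
        rw [← pow_mul, pow_mul 2 (K * e), pow_mul 2 K]
        refine Nat.pow_le_pow_left ((h.bigN_le k (by omega)).trans ?_) _
        exact Nat.pow_le_pow_left Nat.lt_two_pow_self.le _
      have hq : 2 ^ ((L + 2) * (2 * B) * (queryPrefixes (L := L) (n := n) k Z₀ Z').card) ≤
          2 ^ ((L + 2) * (2 * B) * ((∏ j ∈ Finset.range (L - 1), X j) ^ 4 *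
            (Y * ∏ j ∈ Finset.range k, X j))) :=
        Nat.pow_le_pow_right (by norm_num) (Nat.mul_le_mul_left _
          (card_queryPrefixes_le h (by omega) Z₀ hZ₀ Z' fun j hj => hZ' j (by omega)))
      calc Fintype.card (Funs L m n)
          ≤ R₁.card * (2 * 2 ^ Δ * (bigN m n k ^ bigN m n k) ^ X k) := hR₁
        _ ≤ R₁.card * (2 * 2 ^ Δ * 2 ^ (K * e * (bigN m n k * X k))) :=
            Nat.mul_le_mul_left _ (Nat.mul_le_mul_left _ hpow)
        _ ≤ R₃.card * 2 ^ ((L + 2) * (2 * B) * ((∏ j ∈ Finset.range (L - 1), X j) ^ 4 *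
              (Y * ∏ j ∈ Finset.range k, X j))) *
              2 ^ ((L + 2) * (L * ((L + 2) * (2 * B)) * (bigN m n k * X k))) *
              (2 * 2 ^ Δ * 2 ^ (K * e * (bigN m n k * X k))) :=
            Nat.mul_le_mul_right _ (hR₂.trans (Nat.mul_le_mul_right _
              (hR₃.trans (Nat.mul_le_mul_left _ hq))))
        _ = _ := by rw [pow_add, pow_add, pow_add, pow_succ]; ring

/-- The lower bound for all parameters in the regime. -/
theorem not_solves_of_regime (h : Regime L m B n X K Y e) (hL : 1 ≤ L)
    (P : FCProtocol L m n B) : ¬ SolvesFuncComp hL P := by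
  have hYm : Y ≤ m := by
    rw [h.m_eq, mul_comm K Y, mul_assoc]
    refine Nat.le_mul_of_pos_right _ (Nat.mul_pos ?_ (h.prod_pos _))
    have := h.two_le_K; omega
  obtain ⟨Z₀, -, hZ₀⟩ := Finset.exists_subset_card_eq
    (s := (Finset.univ : Finset (Fin m))) (n := Y) (by simpa using hYm)
  obtain ⟨Z, R, A, Δ, -, -, hQ, hAc, hA, hR, hΔ⟩ := exists_blind h P Z₀ hZ₀ (L - 1) (by omega)
  refine not_solves_of_queryBlind hL P Z₀ Z R ⟨L - 1, by omega⟩ rfl A (2 ^ Δ) (h.bigN_pos _) hA hQ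
    hR ?_
  rw [hAc, ← pow_succ']
  have h4 := h.four_le_reachCount (by omega : L - 1 < L)
  refine lt_of_lt_of_le (Nat.pow_lt_pow_right (by norm_num) (by omega)) (Nat.pow_le_pow_left ?_ _)
  exact h.two_le_K.trans (h.K_le_m.trans (h.m_le_bigN _))

end Induction

/-! ### The parameters of the theorem -/

theorem four_mul_geom_succ_le (s : ℕ) : 4 * (∑ i ∈ Finset.range s, 8 ^ i) + 1 ≤ 8 ^ s := by
  induction s with
  | zero => simp
  | succ s ih => rw [Finset.sum_range_succ, pow_succ]; omega

theorem five_mul_geom_succ_le (s : ℕ) : 5 * (∑ i ∈ Finset.range s, 8 ^ i) + 1 ≤ 8 ^ s := by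
  induction s with
  | zero => simp
  | succ s ih => rw [Finset.sum_range_succ, pow_succ]; omega

/-- The number `X_j` of values kept for `z_{j+1}`, chosen so that `n_{j+1} = X_j ^ 4`. -/
def keptCount (L K j : ℕ) : ℕ := K ^ 8 ^ (L - 2 - j)

theorem prod_range_keptCount (l K : ℕ) :
    ∏ j ∈ Finset.range l, keptCount (l + 1) K j = K ^ ∑ i ∈ Finset.range l, 8 ^ i := by
  unfold keptCount
  rw [Finset.prod_pow_eq_pow_sum, ← Finset.sum_range_reflect (fun i => 8 ^ i)]
  exact congrArg _ (Finset.sum_congr rfl fun j _ => congrArg _ (by omega))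

theorem prod_Ico_keptCount {L K k : ℕ} (hk : k + 1 < L) :
    ∏ j ∈ Finset.Ico (k + 1) (L - 1), keptCount L K j =
      K ^ ∑ i ∈ Finset.range (L - 2 - k), 8 ^ i := by
  unfold keptCount
  rw [Finset.prod_pow_eq_pow_sum, ← Finset.sum_range_reflect (fun i => 8 ^ i),
    Finset.sum_Ico_eq_sum_range, show L - 1 - (k + 1) = L - 2 - k by omega]
  exact congrArg _ (Finset.sum_congr rfl fun j _ => congrArg _ (by omega))

/-- The parameters of the theorem leave enough room in every step. -/
theorem regime_param (L H d p : ℕ) (hL : 1 ≤ L) (hH : 1 ≤ H) (hd : 1 ≤ d) (hp : 1 ≤ p) :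
    Regime L (paramM L H d p) (H * d * p) (paramN L H d p) (keptCount L (paramK L H d p))
      (paramK L H d p) (paramK L H d p ^ 8 ^ (L - 1)) (2 * 8 ^ (L - 1)) := by
  obtain ⟨l, rfl⟩ : ∃ l, L = l + 1 := ⟨L - 1, by omega⟩
  set B := H * d * p with hB
  have hBpos : 1 ≤ B := Nat.mul_pos (Nat.mul_pos hH hd) hp
  set K := paramK (l + 1) H d p with hKdef
  have hK : K = (B * (l + 1)) ^ 8 * 8 ^ (2 * (l + 1) ^ 2) := rfl
  set b := B * (l + 1) with hb
  have hbpos : 1 ≤ b := Nat.mul_pos hBpos (Nat.succ_pos l)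
  have hBb : B ≤ b := Nat.le_mul_of_pos_right _ (Nat.succ_pos l)
  have hLb : l + 1 ≤ b := Nat.le_mul_of_pos_left _ hBpos
  have hb8 : b ≤ b ^ 8 := Nat.le_self_pow (by norm_num) b
  have hT : 4 * (2 * 8 ^ (l + 1 - 1)) = 8 ^ (l + 1) := by
    rw [Nat.add_sub_cancel, pow_succ]; ring
  have hpowK : ∀ {c q : ℕ}, c ≤ b ^ 8 → q ≤ 2 * (l + 1) ^ 2 → c * 8 ^ q ≤ K := fun hc hq =>
    hK ▸ Nat.mul_le_mul hc (Nat.pow_le_pow_right (by norm_num) hq)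
  have h64 : 64 * b ^ 8 ≤ K := by
    rw [hK, mul_comm]
    refine Nat.mul_le_mul_left _ ?_
    calc 64 = 8 ^ 2 := by norm_num
      _ ≤ _ := Nat.pow_le_pow_right (by norm_num) (by nlinarith)
  have hb8pos : 1 ≤ b ^ 8 := hbpos.trans hb8
  have hK1 : 1 ≤ K := by omega
  have hn : ∀ j, paramN (l + 1) H d p (j + 1) = keptCount (l + 1) K j ^ 4 := by
    intro j
    rw [paramN, keptCount, ← pow_mul, mul_comm (8 ^ _), ← hKdef]
    congr 3
    omega
  refine
    { two_le_K := by omega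
      e_pos := by positivity
      Y_pos := pow_pos hK1 _
      X_pos := fun j => pow_pos hK1 _
      m_eq := ?_
      n_eq := hn
      X_ge := fun k hk => ?_
      Y_ge := ?_
      dvd_Y := ?_
      bigN_le := ?_
      prefix_budget := fun k hk => ?_
      query_budget := fun k hk => ?_ }
  · rw [Nat.add_sub_cancel, prod_range_keptCount, ← pow_succ', ← pow_add, paramM,
      Finset.sum_range_succ, ← hKdef]
    congr 1; ring
  · rw [prod_Ico_keptCount hk, ← pow_mul, ← pow_succ, keptCount, mul_comm]
    exact Nat.pow_le_pow_right hK1 (four_mul_geom_succ_le _)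
  · rw [Nat.add_sub_cancel, prod_range_keptCount, ← pow_mul, ← pow_succ, mul_comm]
    exact Nat.pow_le_pow_right hK1 (four_mul_geom_succ_le _)
  · rw [hT]
    refine Dvd.dvd.trans ?_ (dvd_pow_self K (by positivity))
    rw [hK, ← pow_mul]
    exact Dvd.dvd.mul_left (pow_dvd_pow _ (by nlinarith)) _
  · -- `m * (∏ X) ^ 4` is the power of `K` with exponent `1 + 8 ^ l + 5 * ∑ 8 ^ i`.
    intro k hk
    rw [bigN_eq_of_pow hn]
    have hle : ∏ j ∈ Finset.range k, keptCount (l + 1) K j ≤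
        ∏ j ∈ Finset.range l, keptCount (l + 1) K j :=
      Finset.prod_le_prod_of_subset_of_one_le' (Finset.range_subset_range.2 (by omega))
        fun j _ _ => Nat.one_le_pow _ _ hK1
    refine (Nat.mul_le_mul_left _ (Nat.pow_le_pow_left hle 4)).trans ?_
    rw [prod_range_keptCount, ← pow_mul, paramM, ← hKdef, ← pow_add, Finset.sum_range_succ]
    refine Nat.pow_le_pow_right hK1 ?_
    have := five_mul_geom_succ_le l
    rw [Nat.add_sub_cancel]
    omega
  · rw [hT]
    have h1 : (l + 1 + 2) * ((l + 1) * ((l + 1 + 2) * (2 * B))) + 2 ≤ K := by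
      have h3 : l + 1 + 2 ≤ 3 * b := by omega
      calc (l + 1 + 2) * ((l + 1) * ((l + 1 + 2) * (2 * B))) + 2
          ≤ 3 * b * (b * (3 * b * (2 * b))) + 2 := by gcongr
        _ = 18 * b ^ 4 + 2 := by ring
        _ ≤ 64 * b ^ 8 := by
            have : b ^ 4 ≤ b ^ 8 := Nat.pow_le_pow_right hbpos (by norm_num)
            omega
        _ ≤ K := h64
    have h2 : K * (2 * 8 ^ (l + 1 - 1)) + (l + 1 + 2) * ((l + 1) * ((l + 1 + 2) * (2 * B))) + 2 ≤
        K * 8 ^ (l + 1) := by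
      have : 1 ≤ 8 ^ l := Nat.one_le_pow _ _ (by norm_num)
      rw [Nat.add_sub_cancel, pow_succ]
      nlinarith
    have h3 : 8 * (8 ^ (l + 1)) ^ (k + 1) * 8 ^ (l + 1) ≤ K := by
      have : 8 * (8 ^ (l + 1)) ^ (k + 1) * 8 ^ (l + 1) =
          1 * 8 ^ (1 + (l + 1) * (k + 1) + (l + 1)) := by
        rw [← pow_mul]; ring
      rw [this]
      exact hpowK hb8pos (by nlinarith)
    calc 8 * (8 ^ (l + 1)) ^ (k + 1) * (K * (2 * 8 ^ (l + 1 - 1)) +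
          (l + 1 + 2) * ((l + 1) * ((l + 1 + 2) * (2 * B))) + 2)
        ≤ 8 * (8 ^ (l + 1)) ^ (k + 1) * (K * 8 ^ (l + 1)) := Nat.mul_le_mul_left _ h2
      _ = (8 * (8 ^ (l + 1)) ^ (k + 1) * 8 ^ (l + 1)) * K := by ring
      _ ≤ K ^ 2 := by rw [sq]; exact Nat.mul_le_mul_right _ h3
  · rw [hT]
    have h3 : (l + 1 + 2) * B ≤ 3 * b := by rw [hb]; nlinarith
    calc 16 * (8 ^ (l + 1)) ^ k * ((l + 1 + 2) * B)
        ≤ 16 * (8 ^ (l + 1)) ^ k * (3 * b) := Nat.mul_le_mul_left _ h3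
      _ ≤ 64 * (8 ^ (l + 1)) ^ k * b := by nlinarith [Nat.zero_le ((8 ^ (l + 1)) ^ k * b)]
      _ = b * 8 ^ (2 + (l + 1) * k) := by rw [← pow_mul]; ring
      _ ≤ K := hpowK hb8 (by nlinarith)

end ARComm

theorem mainTheorem2 (L H d p : ℕ) (hL : 1 ≤ L) (hH : 1 ≤ H) (hd : 1 ≤ d) (hp : 1 ≤ p) :
    ¬ ∃ P : ARComm.FCProtocol L (ARComm.paramM L H d p) (ARComm.paramN L H d p) (H * d * p),
      ARComm.SolvesFuncComp hL P := by
  rintro ⟨P, hP⟩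
  exact ARComm.not_solves_of_regime (ARComm.regime_param L H d p hL hH hd hp) hL P hP
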